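/- **Conventions.** $\{0,1\}^*$ is the set of finite binary words and $|x|$ the length of $x$; for $x,y\in\{0,1\}^*$ put $\langle x,y\rangle := 1^{|x|}0xy$. A partial function $\varphi:\{0,1\}^*\times\{0,1\}^{\mathbb N}\rightharpoonup\{0,1\}^*$ is computable if an algorithm computes $\varphi(x,\mathbf f)$ from $x$ with access to the bits of $\mathbf f$. Fix a universal computable partial function $U$: it is computable, and for every computable partial function $\varphi$ there is $p\in\{0,1\}^*$ with $\varphi(\cdot,\cdot)=U(\langle p,\cdot\rangle,\cdot)$. The algorithmic complexity of $x\in\{0,1\}^*$ is $K[x]:=\min\{|q| : U(q,0^\infty)=x\}$. Let $\beta\in(1,2)$. For $s\in[0,1]$ let $\Sigma_\beta(s)$ be the set of $\beta$-expansions of $s$, i.e. of all $\mathbf x\in\{0,1\}^{\mathbb N}$ with $\sum_{i\ge1}\mathbf x_i\beta^{-i}=s$. Let $\mathbf y$ be the greedy binary expansion of $s$: starting from $r=s$, repeatedly emit $b=0$ if $r<1/2$ and $b=1$ otherwise, and replace $r$ by $2r-b$. Put $n(\beta):=\lceil n\log_\beta 2\rceil$. The random $\beta$-expansion algorithm with input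 $s$, length $m$ and coin tosses $\mathbf t\in\{0,1\}^{\mathbb N}$ starts from $r=s$ and does the following $m$ times: emit $b=0$ if $r<\beta^{-1}$; emit $b=1$ if $r>(\beta(\beta-1))^{-1}$; otherwise emit as $b$ the first unread bit of $\mathbf t$ and mark that bit as read; then replace $r$ by $\beta r-b$. If $x$ is the prefix of length $m$ of a $\beta$-expansion of $s$, then $w_\beta(s,x)$ is the unique word $w\in\{0,1\}^*$ such that the $\mathbf t$ for which the algorithm outputs $x$ are exactly those that begin with $w$. For algebraic $\beta$, the minimal polynomial $P_\beta\in\mathbb Z[X]$ is the integer polynomial of minimal degree with root $\beta$ whose leading coefficient is positive and as small as possible; $L_\beta$ is its leading coefficient, the Galois conjugates of $\beta$ are the complex roots of $P_\beta$ other than $\beta$, and $\Pi_\beta^+:=\prod|z|$ over the Galois conjugates $z$ of $\beta$ with $|z|>1$ (an empty product is $1$). $\beta$ is a Pisot number if it is an algebraic integer all of whose Galois conjugates satisfy $|z|<1$. **Theorem.** Let $\beta\in(1,2)$ be algebraic. There is a constant $C$, depending only on $\beta$ and $U$, such that for all $n\ge1$, all $s\in[0,1]$ with greedy binary expansion $\mathbf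 y$, and all $\mathbf x\in\Sigma_\beta(s)$, $$K\big[\langle \mathbf y_{1:n},\,w_\beta(s,\mathbf x_{1:n(\beta)})\rangle\big]\;\le\;K\big[\mathbf x_{1:n(\beta)}\big]+2n\log_\beta\!\big(L_\beta\,\Pi_\beta^+\big)+C\log(n+1).$$ If moreover $\beta$ is a Pisot number, there is a constant $C$, depending only on $\beta$ and $U$, such that for all $n\ge1$, all $s\in[0,1]$ with greedy binary expansion $\mathbf y$, and all $\mathbf x\in\Sigma_\beta(s)$, $$K\big[\langle \mathbf y_{1:n},\,w_\beta(s,\mathbf x_{1:n(\beta)})\rangle\big]\;\le\;K\big[\mathbf x_{1:n(\beta)}\big]+C.$$ -/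

import Mathlib

/-! Finite binary words are `List Bool`, infinite binary sequences are `ℕ → Bool`
(`true` is the bit 1), indexed from 0: the `i`-th bit of the mathematics is `x (i - 1)`. -/

namespace BetaExpansion

/-- The prefix `x_{1:n}` of an infinite sequence. -/
def take (x : ℕ → Bool) (n : ℕ) : List Bool :=
  (List.range n).map x

/-- The pairing `⟨x, y⟩ = 1^{|x|} 0 x y` of words. -/
def pair (x y : List Bool) : List Bool :=
  List.replicate x.length true ++ [false] ++ x ++ y

/-! ### Algorithmic complexity -/

/-- Computability of a partial function `φ : {0,1}* × {0,1}^ℕ → {0,1}*` whose second argument is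
an infinite sequence that the algorithm may consult. The computable function `g` says what the
algorithm on input `x` has delivered within `n` steps, when it is given the first `n` bits of the
sequence; the computation halts iff some `n` is large enough. -/
def IsComputable (φ : List Bool → (ℕ → Bool) → Part (List Bool)) : Prop :=
  ∃ g : List Bool × List Bool → Option (List Bool), Computable g ∧
    ∀ (x : List Bool) (f : ℕ → Bool) (y : List Bool),
      y ∈ φ x f ↔ ∃ n : ℕ, g (x, take f n) = some y

/-- A universal (partial) computable function `U`: it is computable, and every computable `φ` has
a program `p` with `φ(·, ·) = U(⟨p, ·⟩, ·)`. -/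
def IsUniversal (U : List Bool → (ℕ → Bool) → Part (List Bool)) : Prop :=
  IsComputable U ∧
    ∀ φ : List Bool → (ℕ → Bool) → Part (List Bool), IsComputable φ →
      ∃ p : List Bool, ∀ (x : List Bool) (f : ℕ → Bool), φ x f = U (pair p x) f

/-- `K_U[x | f]`: the length of a shortest `q` with `U(q, f) = x`. -/
noncomputable def relComplexity (U : List Bool → (ℕ → Bool) → Part (List Bool))
    (x : List Bool) (f : ℕ → Bool) : ℕ :=
  sInf {k : ℕ | ∃ q : List Bool, x ∈ U q f ∧ q.length = k}

/-- `K_U[x] = K_U[x | 0^∞]`. -/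
noncomputable def complexity (U : List Bool → (ℕ → Bool) → Part (List Bool))
    (x : List Bool) : ℕ :=
  relComplexity U x (fun _ => false)

/-- For universal `U` the infimum defining the complexity is over a nonempty set. -/
theorem IsUniversal.exists_program {U : List Bool → (ℕ → Bool) → Part (List Bool)}
    (hU : IsUniversal U) (x : List Bool) (f : ℕ → Bool) : ∃ q : List Bool, x ∈ U q f := by
  obtain ⟨p, hp⟩ := hU.2 (fun x _ => Part.some x)
    ⟨fun a => some a.1, Computable.option_some.comp Computable.fst, fun x f y => by
      simp [Part.mem_some_iff, eq_comm]⟩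
  exact ⟨pair p x, by rw [← hp]; exact Part.mem_some x⟩

/-! ### Expansions of real numbers -/

/-- The set `Σ_β(s)` of `β`-expansions of `s`, the sequences `x` with `∑_{i ≥ 1} x_i β^{-i} = s`. -/
def expansions (β s : ℝ) : Set (ℕ → Bool) :=
  {x | HasSum (fun i : ℕ => ((x i).toNat : ℝ) * (β⁻¹) ^ (i + 1)) s}

/-- One step of the greedy binary algorithm on the remainder `r`: emit `b = 0` if `r < 1/2` and
`b = 1` otherwise, and continue with `2 r - b`. -/
noncomputable def greedyStep (r : ℝ) : ℝ :=
  2 * r - if r < 1 / 2 then 0 else 1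

/-- The greedy binary expansion of `s ∈ [0, 1]`. -/
noncomputable def greedyBinary (s : ℝ) (i : ℕ) : Bool :=
  if greedyStep^[i] s < 1 / 2 then false else true

/-- `n(β) = ⌈n log_β 2⌉`. -/
noncomputable def scaledLength (β : ℝ) (n : ℕ) : ℕ :=
  ⌈(n : ℝ) * Real.logb β 2⌉₊

/-! ### The random `β`-expansion algorithm, driven by a sequence `t` of coin tosses -/

/-- The switch region `S_β = [β⁻¹, ((β - 1) β)⁻¹]`, where the next bit is free. -/
def switchRegion (β : ℝ) : Set ℝ :=
  Set.Icc β⁻¹ ((β - 1) * β)⁻¹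

/-- The next bit, for remainder `r`: 0 to the left of the switch region, 1 to its right, and the
first unread coin toss inside it. -/
noncomputable def nextBit (β r : ℝ) (t : ℕ → Bool) : Bool :=
  if r < β⁻¹ then false else if ((β - 1) * β)⁻¹ < r then true else t 0

open Classical in
/-- One step of the algorithm on (remainder, unread coin tosses): the remainder becomes `β r - b`,
and the first toss is discarded iff `r` is in the switch region. -/
noncomputable def randomStep (β : ℝ) (a : ℝ × (ℕ → Bool)) : ℝ × (ℕ → Bool) :=
  (β * a.1 - ((nextBit β a.1 a.2).toNat : ℝ),
    if a.1 ∈ switchRegion β then fun i => a.2 (i + 1) else a.2)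

/-- The output in `{0,1}^n` of the algorithm on input `s`, with coin tosses `t`. -/
noncomputable def randomExpansion (β s : ℝ) (n : ℕ) (t : ℕ → Bool) : List Bool :=
  (List.range n).map fun i =>
    nextBit β ((randomStep β)^[i] (s, t)).1 ((randomStep β)^[i] (s, t)).2

/-- `w` is the word of coin tosses that produces the output `x`: the tosses that make the algorithm
output `x` on input `s` are exactly those that begin with `w`. -/
def IsCoinTossWord (β s : ℝ) (x w : List Bool) : Prop :=
  {t : ℕ → Bool | randomExpansion β s x.length t = x} = {t : ℕ → Bool | take t w.length = w}

theorem take_succ (x : ℕ → Bool) (n : ℕ) :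
    take x (n + 1) = x 0 :: take (fun i => x (i + 1)) n := by
  simp [take, List.range_succ_eq_map, Function.comp_def]

theorem randomExpansion_succ (β s : ℝ) (n : ℕ) (t : ℕ → Bool) :
    randomExpansion β s (n + 1) t = nextBit β s t ::
      randomExpansion β (randomStep β (s, t)).1 n (randomStep β (s, t)).2 := by
  simp [randomExpansion, List.range_succ_eq_map, Function.comp_def, Function.iterate_succ_apply]

/-- A `β`-expansion of `s` emits the forced bit outside of the switch region, and its tail is a
`β`-expansion of the next remainder. -/
theorem expansions_cons {β s : ℝ} (hβ : β ∈ Set.Ioo (1 : ℝ) 2) {x : ℕ → Bool}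
    (hx : x ∈ expansions β s) :
    (fun i => x (i + 1)) ∈ expansions β (β * s - ((x 0).toNat : ℝ)) ∧
      (x 0 = true → β⁻¹ ≤ s) ∧ (x 0 = false → s ≤ ((β - 1) * β)⁻¹) := by
  have h1 : (1 : ℝ) < β := hβ.1
  have h0 : (0 : ℝ) < β := by linarith
  have hx' : HasSum (fun i : ℕ => ((x i).toNat : ℝ) * (β⁻¹) ^ (i + 1)) s := hx
  have key : HasSum (fun i : ℕ => ((x (i + 1)).toNat : ℝ) * (β⁻¹) ^ (i + 1))
      (β * s - ((x 0).toNat : ℝ)) := by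
    have h := (hasSum_nat_add_iff' 1).2 (hx'.mul_left β)
    have e1 : ∀ (a : ℝ) (k : ℕ), β * (a * (β⁻¹) ^ (k + 1)) = a * (β⁻¹) ^ k := fun a k => by
      rw [pow_succ]
      field_simp
    simpa only [e1, Finset.sum_range_one, pow_zero, mul_one] using h
  have hnn : 0 ≤ β * s - ((x 0).toNat : ℝ) := key.nonneg fun i => by positivity
  have hle : β * s - ((x 0).toNat : ℝ) ≤ (β - 1)⁻¹ := by
    have hg : HasSum (fun i : ℕ => (β⁻¹) ^ (i + 1)) (β - 1)⁻¹ := by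
      have := (hasSum_geometric_of_lt_one (inv_nonneg.2 h0.le) (inv_lt_one_of_one_lt₀ h1)).mul_left
        β⁻¹
      have e1 : β⁻¹ * (1 - β⁻¹)⁻¹ = (β - 1)⁻¹ := by
        rw [← mul_inv, mul_sub, mul_one, mul_inv_cancel₀ h0.ne']
      rw [e1] at this
      simpa only [pow_succ'] using this
    refine hasSum_le (fun i => ?_) key hg
    have : ((x (i + 1)).toNat : ℝ) ≤ 1 := by exact_mod_cast Bool.toNat_le _
    exact mul_le_of_le_one_left (by positivity) this
  refine ⟨key, fun hb => ?_, fun hb => ?_⟩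
  · rw [hb] at hnn
    simp at hnn
    rw [inv_le_iff_one_le_mul₀ h0]
    linarith
  · rw [hb] at hle
    simp at hle
    rw [mul_inv]
    rw [← div_eq_mul_inv, le_div_iff₀ h0]
    linarith

theorem exists_isCoinTossWord {β s : ℝ} (hβ : β ∈ Set.Ioo (1 : ℝ) 2) {x : ℕ → Bool}
    (hx : x ∈ expansions β s) (n : ℕ) : ∃ w : List Bool, IsCoinTossWord β s (take x n) w := by
  induction n generalizing s x with
  | zero => exact ⟨[], by simp [IsCoinTossWord, take, randomExpansion]⟩
  | succ n ih =>
    have h1 : (1 : ℝ) < β := hβ.1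
    have h0 : (0 : ℝ) < β := by linarith
    obtain ⟨hc, ht, hf⟩ := expansions_cons hβ hx
    obtain ⟨w, hw⟩ := ih hc
    have hlen : ∀ y : ℕ → Bool, (take y n).length = n := by simp [take]
    simp only [IsCoinTossWord, hlen, Set.ext_iff, Set.mem_ofPred_eq] at hw
    by_cases hs : s ∈ switchRegion β
    · refine ⟨x 0 :: w, ?_⟩
      have hbit : ∀ t, nextBit β s t = t 0 := fun t => by
        rw [nextBit, if_neg (not_lt.2 hs.1), if_neg (not_lt.2 hs.2)]
      simp only [IsCoinTossWord, Set.ext_iff, Set.mem_ofPred_eq]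
      intro t
      rw [take_succ x, List.length_cons, hlen, randomExpansion_succ, hbit, List.length_cons,
        take_succ t, List.cons_eq_cons, List.cons_eq_cons]
      refine and_congr_right fun h => ?_
      rw [← hw]
      simp [randomStep, hs, hbit, h]
    · refine ⟨w, ?_⟩
      have hbit : ∀ t, nextBit β s t = x 0 := fun t => by
        unfold nextBit
        cases hb : x 0
        · have := hf hb
          by_cases h : s < β⁻¹
          · simp [h]
          · exact absurd ⟨not_lt.1 h, this⟩ hs
        · have := ht hb
          by_cases h : ((β - 1) * β)⁻¹ < s
          · rw [if_neg (not_lt.2 this), if_pos h]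
          · exact absurd ⟨this, not_lt.1 h⟩ hs
      simp only [IsCoinTossWord, Set.ext_iff, Set.mem_ofPred_eq]
      intro t
      rw [take_succ x, List.length_cons, hlen, randomExpansion_succ, hbit, List.cons_eq_cons,
        ← hw]
      simp [randomStep, hs, hbit]

theorem IsCoinTossWord.unique {β s : ℝ} {x v w : List Bool} (hv : IsCoinTossWord β s x v)
    (hw : IsCoinTossWord β s x w) : v = w := by
  have h : {t : ℕ → Bool | take t v.length = v} = {t : ℕ → Bool | take t w.length = w} :=
    hv.symm.trans hw
  clear hv hw
  simp only [Set.ext_iff, Set.mem_ofPred_eq] at h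
  have key : ∀ (u : List Bool) (c : Bool), take (fun i => u.getD i c) u.length = u := by
    intro u c
    refine List.ext_getElem (by simp [take]) fun i h1 h2 => ?_
    simp [take, h2]
  have lt : ∀ {a b : List Bool}, (∀ t : ℕ → Bool, take t a.length = a → take t b.length = b) →
      b.length ≤ a.length := by
    intro a b hab
    by_contra hlt
    push Not at hlt
    have h1 := hab _ (key a true)
    have h2 := hab _ (key a false)
    have h3 := congrArg (fun l : List Bool => l[a.length]?) (h1.trans h2.symm)
    simp [take, hlt] at h3
  have hl : v.length = w.length := le_antisymm (lt fun t => (h t).2) (lt fun t => (h t).1)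
  have h1 := key v true
  have h2 := (h _).1 h1
  rw [← hl] at h2
  exact h1.symm.trans h2

/-- `w_β(s, x)`, for a prefix `x` of a `β`-expansion of `s`; it exists and is unique by
`exists_isCoinTossWord` and `IsCoinTossWord.unique`. -/
noncomputable def coinTossWord (β s : ℝ) (x : List Bool) : List Bool :=
  Classical.epsilon (IsCoinTossWord β s x)

/-! ### Algebraic numbers -/

/-- `P` is the minimal polynomial of the algebraic number `β` in `ℤ[X]`: a nonzero integer
polynomial with root `β`, of minimal degree, with positive leading coefficient, and with least
leading coefficient among those. -/
def IsIntMinpoly (β : ℝ) (P : Polynomial ℤ) : Prop :=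
  Polynomial.aeval β P = 0 ∧ 0 < P.leadingCoeff ∧
    (∀ Q : Polynomial ℤ, Q ≠ 0 → Polynomial.aeval β Q = 0 → P.natDegree ≤ Q.natDegree) ∧
    ∀ Q : Polynomial ℤ, Polynomial.aeval β Q = 0 → Q.natDegree = P.natDegree →
      0 < Q.leadingCoeff → P.leadingCoeff ≤ Q.leadingCoeff

theorem exists_isIntMinpoly {β : ℝ} (hβ : IsAlgebraic ℤ β) : ∃ P, IsIntMinpoly β P := by
  classical
  have hd : ∃ d : ℕ, ∃ Q : Polynomial ℤ, Q ≠ 0 ∧ Polynomial.aeval β Q = 0 ∧ Q.natDegree = d := by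
    obtain ⟨Q, h1, h2⟩ := hβ
    exact ⟨_, Q, h1, h2, rfl⟩
  have hc : ∃ c : ℕ, 0 < c ∧ ∃ Q : Polynomial ℤ, Polynomial.aeval β Q = 0 ∧
      Q.natDegree = Nat.find hd ∧ Q.leadingCoeff = (c : ℤ) := by
    obtain ⟨Q, h1, h2, h3⟩ := Nat.find_spec hd
    have hl : Q.leadingCoeff ≠ 0 := Polynomial.leadingCoeff_ne_zero.2 h1
    refine ⟨Q.leadingCoeff.natAbs, Int.natAbs_pos.2 hl, ?_⟩
    rcases le_total 0 Q.leadingCoeff with h | h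
    · exact ⟨Q, h2, h3, by omega⟩
    · exact ⟨-Q, by simp [h2], by simp [h3], by rw [Polynomial.leadingCoeff_neg]; omega⟩
  obtain ⟨h0, P, h1, h2, h3⟩ := Nat.find_spec hc
  refine ⟨P, h1, by rw [h3]; exact_mod_cast h0, fun Q hQ hr => ?_, fun Q hr hdeg hpos => ?_⟩
  · rw [h2]
    exact Nat.find_min' hd ⟨Q, hQ, hr, rfl⟩
  · rw [h3]
    have := Nat.find_min' hc ⟨by omega, Q, hr, hdeg.trans h2, (Int.toNat_of_nonneg hpos.le).symm⟩
    omega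

/-- The minimal polynomial `P_β ∈ ℤ[X]` of an algebraic number; see `exists_isIntMinpoly`. -/
noncomputable def intMinpoly (β : ℝ) : Polynomial ℤ :=
  Classical.epsilon (IsIntMinpoly β)

/-- `L_β`, the leading coefficient of the minimal polynomial. -/
noncomputable def leadCoeff (β : ℝ) : ℤ :=
  (intMinpoly β).leadingCoeff

/-- The Galois conjugates of `β`, the complex roots of `P_β` other than `β`. -/
noncomputable def conjugates (β : ℝ) : Finset ℂ :=
  ((intMinpoly β).aroots ℂ).toFinset.erase (β : ℂ)

/-- `Π_β^+`, the product of the moduli of the Galois conjugates of modulus greater than 1. -/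
noncomputable def outerProduct (β : ℝ) : ℝ :=
  ∏ z ∈ (conjugates β).filter (fun z => 1 < ‖z‖), ‖z‖

/-- Pisot numbers (for `β > 1`): algebraic integers whose Galois conjugates all lie in the open
unit disk. -/
def IsPisot (β : ℝ) : Prop :=
  IsIntegral ℤ β ∧ ∀ z ∈ conjugates β, ‖z‖ < 1

end BetaExpansion

namespace BetaExpansion

/-! Let m = n(β) and let x be the prefix of length m. It determines s up to O(β^{-m}) = O(2^{-n}),
so the integer with digits y_{1:n} is known up to boundedly many candidates (`binaryApprox_bounds`).
The coin toss word is the subsequence of x at the positions whose remainder is in the switch region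
(`coinTossWord_eq_selectWord`). The digit x_i already gives one of the two inequalities defining
that region; the other one compares (β - 1) β^m s with a threshold that depends on x and i only
(`mem_switchRegion_iff`). What is missing is therefore the place of s among m + 1 thresholds. The
positions that pass a comparison with s form an initial segment in the order of the thresholds, and
naming the largest threshold in it takes O(log m) bits.

The decoder must order the thresholds, ties included. They are values at β of integer polynomials of
degree at most m with bounded coefficients, and a norm argument bounds their nonzero differences
below by c B^{-m} (`exists_le_pow_mul_abs_aeval`). Hence O(m) binary digits of β suffice, and these
are computable (`primrec_floor_mul_two_pow`). So `decode` is primitive recursive and needs O(log n)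
bits of advice, which `IsUniversal.complexity_le_of_primrec` turns into the first bound; its linear
term is nonnegative and is given away.

For Pisot β the separation is a constant (`IsPisot.exists_le_abs_aeval`, Garsia's lemma). Since (β -
1) β^m s exceeds the last threshold by at most 1, the cut can be described by a bounded multiple of
a fixed step above that threshold (`exists_cut_offset`), and the advice takes boundedly many values.
-/

/-! ### Complexity of computable images -/

/-- The number with the binary digits `e`, least significant digit first. -/
def ofBits (e : List Bool) : ℕ :=
  e.foldr (fun b n => 2 * n + b.toNat) 0

theorem exists_ofBits_eq (a : ℕ) : ∃ e : List Bool, ofBits e = a ∧ e.length = a.size := by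
  induction a using Nat.binaryRec' with
  | zero => exact ⟨[], rfl, by simp⟩
  | bit b n h ih =>
    obtain ⟨e, he, hl⟩ := ih
    refine ⟨b :: e, ?_, ?_⟩
    · rw [Nat.bit_val, ← he]
      rfl
    · rw [Nat.size_bit, List.length_cons, hl]
      intro h0
      rw [Nat.bit_eq_zero_iff] at h0
      have := h h0.1
      rw [h0.2] at this
      cases this

theorem primrec_ofBits : Primrec ofBits :=
  Primrec.list_foldr (h := fun _ (p : Bool × ℕ) => 2 * p.2 + p.1.toNat) Primrec.id (Primrec.const 0)
    (Primrec.nat_add.comp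
      (Primrec.nat_mul.comp (Primrec.const 2) (Primrec.snd.comp Primrec.snd))
      ((Primrec.dom_bool Bool.toNat).comp (Primrec.fst.comp Primrec.snd))).to₂

/-- A left inverse of the pairing of words. -/
def unpair (z : List Bool) : List Bool × List Bool :=
  ((z.drop ((z.takeWhile id).length + 1)).take (z.takeWhile id).length,
    (z.drop ((z.takeWhile id).length + 1)).drop (z.takeWhile id).length)

theorem takeWhile_pair (x y : List Bool) :
    (pair x y).takeWhile id = List.replicate x.length true := by
  simp [pair]

theorem unpair_pair (x y : List Bool) : unpair (pair x y) = (x, y) := by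
  have h : (pair x y).drop (x.length + 1) = x ++ y := by
    rw [pair, List.append_assoc, List.drop_left' (by simp)]
  simp [unpair, takeWhile_pair, h]

theorem length_pair (x y : List Bool) : (pair x y).length = 2 * x.length + 1 + y.length := by
  simp [pair]
  ring

theorem primrec_unpair : Primrec unpair := by
  have hk : Primrec fun z : List Bool => (z.takeWhile id).length :=
    Primrec.list_length.comp (Primrec.list_takeWhile Primrec.id)
  have hd : Primrec fun z : List Bool => z.drop ((z.takeWhile id).length + 1) :=
    Primrec.list_drop.comp (Primrec.succ.comp hk) Primrec.id
  exact Primrec.pair (Primrec.list_take.comp hk hd) (Primrec.list_drop.comp hk hd)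

theorem primrec_pair : Primrec₂ pair := by
  have hr : Primrec fun z : List Bool × List Bool => List.replicate z.1.length true := by
    refine (Primrec.list_map (g := fun _ _ => true)
      (Primrec.list_range.comp (Primrec.list_length.comp Primrec.fst))
      (Primrec.const true).to₂).of_eq fun z => ?_
    simp
  exact Primrec.list_append.comp
    (Primrec.list_append.comp
      (Primrec.list_append.comp hr (Primrec.const [false])) Primrec.fst) Primrec.snd

/-- The program is ⟨p, ⟨e, q⟩⟩ with e the digits of the advice and q a shortest program for x.
Pairing makes e self-delimiting by doubling its length, whence the factor 2; the part due to p is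
constant. -/
theorem IsUniversal.complexity_le_of_primrec {U : List Bool → (ℕ → Bool) → Part (List Bool)}
    (hU : IsUniversal U) {E : List Bool → ℕ → List Bool} (hE : Primrec₂ E) :
    ∃ C : ℕ, ∀ (x : List Bool) (a : ℕ),
      complexity U (E x a) ≤ complexity U x + 2 * a.size + C := by
  obtain ⟨⟨g, hg, hgU⟩, huniv⟩ := hU
  have hcomp : IsComputable fun z f =>
      (U (unpair z).2 f).map fun x => E x (ofBits (unpair z).1) := by
    refine ⟨fun p => (g ((unpair p.1).2, p.2)).map fun x => E x (ofBits (unpair p.1).1), ?_, ?_⟩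
    · refine Computable.option_map (g := fun (p : List Bool × List Bool) x =>
        E x (ofBits (unpair p.1).1)) (hg.comp (Primrec.pair
          (Primrec.snd.comp (primrec_unpair.comp Primrec.fst)) Primrec.snd).to_comp) ?_
      exact (hE.comp Primrec.snd (primrec_ofBits.comp (Primrec.fst.comp
        (primrec_unpair.comp (Primrec.fst.comp Primrec.fst))))).to_comp.to₂
    · intro x f y
      simp only [Part.mem_map_iff, Option.map_eq_some_iff, hgU]
      constructor
      · rintro ⟨a, ⟨n, h⟩, e⟩
        exact ⟨n, a, h, e⟩
      · rintro ⟨n, a, h, e⟩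
        exact ⟨a, ⟨n, h⟩, e⟩
  obtain ⟨p, hp⟩ := huniv _ hcomp
  refine ⟨2 * p.length + 2, fun x a => ?_⟩
  obtain ⟨e, he, hl⟩ := exists_ofBits_eq a
  have hne : {k : ℕ | ∃ q : List Bool, x ∈ U q (fun _ => false) ∧ q.length = k}.Nonempty := by
    obtain ⟨q, hq⟩ := IsUniversal.exists_program ⟨⟨g, hg, hgU⟩, huniv⟩ x (fun _ => false)
    exact ⟨_, q, hq, rfl⟩
  obtain ⟨q, hq, hql⟩ := Nat.sInf_mem hne
  have hmem : E x a ∈ U (pair p (pair e q)) (fun _ => false) := by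
    rw [← hp]
    simp only [unpair_pair, he]
    exact Part.mem_map _ hq
  have hle : complexity U (E x a) ≤ (pair p (pair e q)).length := Nat.sInf_le ⟨_, hmem, rfl⟩
  have hx : complexity U x = q.length := hql.symm
  rw [length_pair, length_pair, hl] at hle
  omega

/-! ### Computing binary approximations of an algebraic number -/

theorem primrec_pow : Primrec₂ ((· ^ ·) : ℕ → ℕ → ℕ) :=
  Primrec₂.unpaired'.1 Nat.Primrec.pow

theorem primrec_sum_range_fixed {α : Type*} [Primcodable α] (f : ℕ → α → ℕ)
    (hf : ∀ i, Primrec (f i)) (d : ℕ) :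
    Primrec fun a => ∑ i ∈ Finset.range d, f i a := by
  induction d with
  | zero => simpa using Primrec.const 0
  | succ d ih =>
    simp only [Finset.sum_range_succ]
    exact Primrec.nat_add.comp ih (hf d)

theorem primrec_sum_range {α : Type*} [Primcodable α] {f : α → ℕ → ℕ} (hf : Primrec₂ f)
    {d : α → ℕ} (hd : Primrec d) :
    Primrec fun a => ∑ i ∈ Finset.range (d a), f a i := by
  refine (Primrec.nat_rec' (h := fun a (p : ℕ × ℕ) => p.2 + f a p.1) hd (Primrec.const 0)
    (Primrec.nat_add.comp (Primrec.snd.comp Primrec.snd)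
      (hf.comp Primrec.fst (Primrec.fst.comp Primrec.snd))).to₂).of_eq fun a => ?_
  induction d a with
  | zero => rfl
  | succ n ih => rw [Finset.sum_range_succ, ← ih]

/-- The sign of an integer polynomial at a quotient of natural numbers is a primitive recursive
function. -/
theorem exists_primrec_eval_div_nonpos (P : Polynomial ℤ) :
    ∃ R : ℕ → ℕ → Bool, Primrec₂ R ∧
      ∀ j M : ℕ, 0 < M → (R j M = true ↔ Polynomial.aeval ((j : ℝ) / M) P ≤ 0) := by
  -- Denominators are cleared by M ^ natDegree, and positive and negative parts of the coefficients
  -- are summed separately, so that the sign is a comparison in ℕ.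
  let F : (ℤ → ℕ) → ℕ × ℕ → ℕ := fun c p =>
    ∑ i ∈ Finset.range (P.natDegree + 1), c (P.coeff i) * (p.1 ^ i * p.2 ^ (P.natDegree - i))
  have hF : ∀ c, Primrec (F c) := fun c => primrec_sum_range_fixed
    (fun i (p : ℕ × ℕ) => c (P.coeff i) * (p.1 ^ i * p.2 ^ (P.natDegree - i)))
    (fun i => Primrec.nat_mul.comp (Primrec.const _) (Primrec.nat_mul.comp
      (primrec_pow.comp Primrec.fst (Primrec.const _))
      (primrec_pow.comp Primrec.snd (Primrec.const _)))) _
  refine ⟨fun j M => decide (F Int.toNat (j, M) ≤ F (fun z => (-z).toNat) (j, M)),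
    (PrimrecRel.comp Primrec.nat_le (hF Int.toNat) (hF fun z => (-z).toNat)).decide.to₂,
    fun j M hM => ?_⟩
  have hM' : (0 : ℝ) < M := by exact_mod_cast hM
  have key : ((F Int.toNat (j, M) : ℕ) : ℝ) - ((F (fun z => (-z).toNat) (j, M) : ℕ) : ℝ) =
      (M : ℝ) ^ P.natDegree * Polynomial.aeval ((j : ℝ) / M) P := by
    rw [Polynomial.aeval_eq_sum_range, Finset.mul_sum]
    simp only [F]
    push_cast
    rw [← Finset.sum_sub_distrib]
    refine Finset.sum_congr rfl fun i hi => ?_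
    have hi' : i ≤ P.natDegree := Nat.lt_succ_iff.1 (Finset.mem_range.1 hi)
    have hz : ((P.coeff i).toNat : ℝ) - ((-P.coeff i).toNat : ℝ) = (P.coeff i : ℝ) := by
      exact_mod_cast Int.toNat_sub_toNat_neg (P.coeff i)
    have hp : (M : ℝ) ^ P.natDegree = (M : ℝ) ^ (P.natDegree - i) * (M : ℝ) ^ i := by
      rw [← pow_add, Nat.sub_add_cancel hi']
    rw [← sub_mul, hz, zsmul_eq_mul, hp, div_pow]
    field_simp
  rw [decide_eq_true_iff, ← Nat.cast_le (α := ℝ), ← sub_nonpos, key]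
  exact mul_nonpos_iff_pos_imp_nonpos.trans
    ⟨fun h => h.1 (by positivity), fun h => ⟨fun _ => h, fun _ => by positivity⟩⟩

/-- The derivative is a nonzero polynomial of smaller degree, so minimality forbids the root β. -/
theorem IsIntMinpoly.aeval_derivative_ne_zero {β : ℝ} {P : Polynomial ℤ} (hP : IsIntMinpoly β P) :
    Polynomial.aeval β (Polynomial.derivative P) ≠ 0 := by
  intro h
  have hP0 : P ≠ 0 := fun h0 => by simpa [h0] using hP.2.1
  have hd : P.natDegree ≠ 0 := fun h0 => by
    obtain ⟨c, hc⟩ := Polynomial.natDegree_eq_zero.1 h0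
    have h1 := hP.1
    rw [← hc, Polynomial.aeval_C, algebraMap_int_eq, eq_intCast, Int.cast_eq_zero] at h1
    exact hP0 (by rw [← hc, h1, map_zero])
  have hd' : Polynomial.derivative P ≠ 0 := fun h0 =>
    hd (Polynomial.derivative_eq_zero.1 h0)
  exact (hP.2.2.1 _ hd' h).not_gt (Polynomial.natDegree_derivative_lt hd)

/-- Near a simple root, the sign of an integer polynomial or of its negative decides on which side
of the root a point is. -/
theorem exists_polynomial_sign {β : ℝ} (hβ : IsAlgebraic ℤ β) :
    ∃ P : Polynomial ℤ, ∃ δ > 0, ∀ y : ℝ, |y - β| < δ →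
      (Polynomial.aeval y P ≤ 0 ↔ y ≤ β) := by
  obtain ⟨P₀, hP₀⟩ := exists_isIntMinpoly hβ
  have hex : ∃ P : Polynomial ℤ, Polynomial.aeval β P = 0 ∧
      0 < Polynomial.aeval β (Polynomial.derivative P) := by
    rcases lt_or_gt_of_ne hP₀.aeval_derivative_ne_zero with h | h
    · exact ⟨-P₀, by simp [hP₀.1], by simpa using h⟩
    · exact ⟨P₀, hP₀.1, h⟩
  obtain ⟨P, h0, h1⟩ := hex
  have hcont : Continuous fun y : ℝ => Polynomial.aeval y (Polynomial.derivative P) :=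
    Polynomial.continuous_aeval _
  obtain ⟨δ, hδ, hball⟩ := Metric.eventually_nhds_iff.1
    (hcont.continuousAt.eventually (lt_mem_nhds h1))
  refine ⟨P, δ, hδ, fun y hy => ?_⟩
  have hmono : StrictMonoOn (fun y : ℝ => Polynomial.aeval y P) (Metric.ball β δ) := by
    refine strictMonoOn_of_deriv_pos (convex_ball β δ)
      (Polynomial.continuous_aeval _).continuousOn fun z hz => ?_
    rw [Polynomial.deriv_aeval]
    exact hball (Metric.mem_ball.1 (interior_subset hz))
  have := hmono.le_iff_le (a := y) (b := β) hy (Metric.mem_ball_self hδ)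
  simpa [h0] using this

/-- Bisection: the next binary digit is 1 iff the midpoint of the current dyadic interval is at most
β. From precision `N₀` on, the midpoint is within δ of β and the sign of P there decides; the first
`N₀` digits are hardwired. -/
theorem primrec_floor_mul_two_pow {β : ℝ} (h0 : 0 ≤ β) (hβ : IsAlgebraic ℤ β) :
    Primrec fun N : ℕ => ⌊β * 2 ^ N⌋₊ := by
  obtain ⟨P, δ, hδ, hP⟩ := exists_polynomial_sign hβ
  obtain ⟨R, hR, hRP⟩ := exists_primrec_eval_div_nonpos P
  obtain ⟨N₀, hN₀⟩ := exists_pow_lt_of_lt_one hδ (by norm_num : (1 / 2 : ℝ) < 1)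
  let step : ℕ → ℕ → ℕ := fun N b =>
    2 * b + cond (R (2 * b + 1) (2 ^ (N₀ + N + 1))) 1 0
  have hstep : ∀ N, ⌊β * 2 ^ (N₀ + (N + 1))⌋₊ = step N ⌊β * 2 ^ (N₀ + N)⌋₊ := by
    intro N
    set b := ⌊β * 2 ^ (N₀ + N)⌋₊ with hb
    have hb1 : (b : ℝ) ≤ β * 2 ^ (N₀ + N) := Nat.floor_le (by positivity)
    have hb2 : β * 2 ^ (N₀ + N) < b + 1 := Nat.lt_floor_add_one _
    have hpos : (0 : ℝ) < 2 ^ (N₀ + N) := by positivity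
    have e : (2 : ℝ) ^ (N₀ + (N + 1)) = 2 * 2 ^ (N₀ + N) := by rw [← add_assoc, pow_succ']
    have hsm : (1 / 2 : ℝ) * (2 ^ (N₀ + N))⁻¹ < δ := by
      refine lt_of_le_of_lt ?_ hN₀
      rw [pow_add, mul_inv, one_div, inv_pow]
      have : ((2 : ℝ) ^ N)⁻¹ ≤ 1 := inv_le_one_of_one_le₀ (one_le_pow₀ (by norm_num))
      have h2 : (0 : ℝ) < ((2 : ℝ) ^ N₀)⁻¹ := by positivity
      nlinarith
    have hR1 := hRP (2 * b + 1) (2 ^ (N₀ + N + 1)) (by positivity)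
    push_cast at hR1
    rw [add_assoc N₀ N 1, e] at hR1
    have hnear : |(2 * (b : ℝ) + 1) / (2 * 2 ^ (N₀ + N)) - β| < δ := by
      refine lt_of_le_of_lt ?_ hsm
      have : (2 * (b : ℝ) + 1) / (2 * 2 ^ (N₀ + N)) - β =
          ((b : ℝ) + 1 / 2 - β * 2 ^ (N₀ + N)) * (2 ^ (N₀ + N))⁻¹ := by
        field_simp
      rw [this, abs_mul, abs_of_pos (inv_pos.2 hpos)]
      refine mul_le_mul_of_nonneg_right ?_ (by positivity)
      rw [abs_le]
      constructor <;> linarith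
    rw [hP _ hnear, div_le_iff₀ (by positivity)] at hR1
    have hcase : ∀ c : Bool, (c = true ↔ 2 * (b : ℝ) + 1 ≤ β * (2 * 2 ^ (N₀ + N))) →
        ⌊β * 2 ^ (N₀ + (N + 1))⌋₊ = 2 * b + cond c 1 0 := by
      intro c hc
      rw [e, Nat.floor_eq_iff (by positivity)]
      cases c
      · have : ¬ (2 * (b : ℝ) + 1 ≤ β * (2 * 2 ^ (N₀ + N))) := by simpa using hc
        push Not at this
        push_cast
        simp only [cond_false]
        push_cast
        constructor <;> linarith
      · have := hc.1 rfl
        simp only [cond_true]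
        push_cast
        constructor <;> linarith
    refine hcase _ ?_
    rw [add_assoc N₀ N 1]
    exact hR1
  have hrec : Primrec (Nat.rec (motive := fun _ => ℕ) ⌊β * 2 ^ N₀⌋₊ step) := by
    refine Primrec.nat_rec₁ _ ?_
    have hd : Primrec fun p : ℕ × ℕ => 2 * p.2 :=
      Primrec.nat_mul.comp (Primrec.const 2) Primrec.snd
    refine Primrec.nat_add.comp hd (Primrec.cond (hR.comp (Primrec.succ.comp hd) ?_)
      (Primrec.const 1) (Primrec.const 0))
    exact primrec_pow.comp (Primrec.const 2)
      (Primrec.succ.comp (Primrec.nat_add.comp (Primrec.const N₀) Primrec.fst))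
  have hfl : Primrec fun N : ℕ => ⌊β * 2 ^ (N₀ + N)⌋₊ := by
    refine hrec.of_eq fun N => ?_
    induction N with
    | zero => rfl
    | succ N ih => rw [hstep, ← ih]
  -- Computing `N₀` extra digits and dropping them covers all precisions, small ones included.
  refine (Primrec.nat_div.comp hfl (Primrec.const (2 ^ N₀))).of_eq fun N => ?_
  rw [← Nat.floor_div_natCast]
  congr 1
  push_cast
  rw [pow_add]
  field_simp

/-! ### Integer polynomials with bounded coefficients at an algebraic number -/

/-- The product is the absolute value of the norm of q, a nonzero rational integer. -/
theorem one_le_prod_norm_embeddings {K : Type*} [Field K] [Algebra ℚ K] [FiniteDimensional ℚ K]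
    {q : K} (hq : IsIntegral ℤ q) (h0 : q ≠ 0) : 1 ≤ ∏ σ : K →ₐ[ℚ] ℂ, ‖σ q‖ := by
  have hint : IsIntegral ℤ (Algebra.norm ℚ q) := Algebra.isIntegral_norm ℚ hq
  obtain ⟨z, hz⟩ := IsIntegrallyClosed.isIntegral_iff.1 hint
  have hz0 : z ≠ 0 := by
    rintro rfl
    rw [map_zero] at hz
    exact h0 (Algebra.norm_eq_zero_iff.1 hz.symm)
  have h := Algebra.norm_eq_prod_embeddings ℚ ℂ q
  rw [← hz] at h
  rw [← norm_prod, ← h]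
  simp only [algebraMap_int_eq, eq_intCast, eq_ratCast, Rat.cast_intCast, Complex.norm_intCast]
  exact_mod_cast Int.one_le_abs hz0

theorem isIntegral_pow_mul_aeval {K : Type*} [Field K] {a : K} {L : ℤ}
    (h : IsIntegral ℤ ((L : K) * a)) (Q : Polynomial ℤ) :
    IsIntegral ℤ ((L : K) ^ Q.natDegree * Polynomial.aeval a Q) := by
  rw [Polynomial.aeval_eq_sum_range, Finset.mul_sum]
  refine IsIntegral.sum _ fun i hi => ?_
  have hi' : i ≤ Q.natDegree := Nat.lt_succ_iff.1 (Finset.mem_range.1 hi)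
  have e : (L : K) ^ Q.natDegree * (Q.coeff i • a ^ i) =
      ((Q.coeff i * L ^ (Q.natDegree - i) : ℤ) : K) * ((L : K) * a) ^ i := by
    obtain ⟨k, hk⟩ := Nat.exists_eq_add_of_le hi'
    rw [hk, Nat.add_sub_cancel_left, zsmul_eq_mul]
    push_cast
    ring
  rw [e]
  exact (isIntegral_algebraMap (R := ℤ) (A := K)).mul (h.pow i)

theorem norm_aeval_le {Q : Polynomial ℤ} {H : ℝ} (hQ : ∀ k, |(Q.coeff k : ℝ)| ≤ H) (z : ℂ) :
    ‖Polynomial.aeval z Q‖ ≤ H * ∑ i ∈ Finset.range (Q.natDegree + 1), ‖z‖ ^ i := by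
  rw [Polynomial.aeval_eq_sum_range, Finset.mul_sum]
  refine norm_sum_le_of_le _ fun i _ => ?_
  rw [zsmul_eq_mul, norm_mul, norm_pow, Complex.norm_intCast]
  exact mul_le_mul_of_nonneg_right (hQ i) (by positivity)

open IntermediateField in
/-- A lower bound for the value at `β` of an integer polynomial, from upper bounds for its values at
the conjugates of `β`. -/
theorem exists_one_le_mul_abs_aeval {β : ℝ} (hβ : IsIntegral ℚ β) :
    ∃ (Z : Finset ℂ) (d : ℕ), (∀ z ∈ Z, ∀ P : Polynomial ℤ, Polynomial.aeval β P = 0 →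
        Polynomial.aeval z P = 0) ∧
      ∀ (L : ℤ), 1 ≤ L → IsIntegral ℤ ((L : ℝ) * β) → ∀ (Q : Polynomial ℤ) (A : ℝ), 1 ≤ A →
        (∀ z ∈ Z, z ≠ (β : ℂ) → ‖Polynomial.aeval z Q‖ ≤ A) → Polynomial.aeval β Q ≠ 0 →
        1 ≤ (((L : ℝ) ^ Q.natDegree) * A) ^ d * |Polynomial.aeval β Q| := by
  classical
  have : FiniteDimensional ℚ ℚ⟮β⟯ := adjoin.finiteDimensional hβ
  set α : ℚ⟮β⟯ := AdjoinSimple.gen ℚ β with hα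
  have hαβ : algebraMap ℚ⟮β⟯ ℝ α = β := AdjoinSimple.algebraMap_gen ℚ β
  have hinj : Function.Injective (algebraMap ℚ⟮β⟯ ℝ) := (algebraMap ℚ⟮β⟯ ℝ).injective
  have hmap : ∀ P : Polynomial ℤ, algebraMap ℚ⟮β⟯ ℝ (Polynomial.aeval α P) =
      Polynomial.aeval β P := fun P => by
    rw [← Polynomial.aeval_algebraMap_apply, hαβ]
  have hσ : ∀ (σ : ℚ⟮β⟯ →ₐ[ℚ] ℂ) (P : Polynomial ℤ), σ (Polynomial.aeval α P) =
      Polynomial.aeval (σ α) P := fun σ P => by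
    have := Polynomial.map_aeval_eq_aeval_map (R := ℤ) (φ := RingHom.id ℤ) (ψ := (σ : ℚ⟮β⟯ →+* ℂ))
      (by ext; simp) P α
    simpa using this
  let σ₀ : ℚ⟮β⟯ →ₐ[ℚ] ℂ := (Algebra.ofId ℝ ℂ).restrictScalars ℚ |>.comp ℚ⟮β⟯.val
  have hσ₀ : ∀ y, σ₀ y = ((algebraMap ℚ⟮β⟯ ℝ y : ℝ) : ℂ) := fun y => rfl
  refine ⟨Finset.univ.image fun σ : ℚ⟮β⟯ →ₐ[ℚ] ℂ => σ α,
    Fintype.card (ℚ⟮β⟯ →ₐ[ℚ] ℂ), ?_, ?_⟩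
  · intro z hz P hP
    obtain ⟨σ, -, rfl⟩ := Finset.mem_image.1 hz
    rw [← hσ, hinj ((hmap P).trans (hP.trans (map_zero _).symm)), map_zero]
  · intro L hL hLβ Q A hA hZ hQ
    have hL' : (1 : ℝ) ≤ L := by exact_mod_cast hL
    have hLα : IsIntegral ℤ ((L : ℚ⟮β⟯) * α) := by
      refine (isIntegral_algHom_iff (ℚ⟮β⟯.val.restrictScalars ℤ) hinj).1 ?_
      simpa [hα] using hLβ
    have hne : (L : ℚ⟮β⟯) ^ Q.natDegree * Polynomial.aeval α Q ≠ 0 := by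
      refine mul_ne_zero (pow_ne_zero _ (Int.cast_ne_zero.2 (by omega))) fun h => hQ ?_
      rw [← hmap, h, map_zero]
    have h1 := one_le_prod_norm_embeddings (isIntegral_pow_mul_aeval hLα Q) hne
    have e1 : ∀ σ : ℚ⟮β⟯ →ₐ[ℚ] ℂ, ‖σ ((L : ℚ⟮β⟯) ^ Q.natDegree * Polynomial.aeval α Q)‖ =
        (L : ℝ) ^ Q.natDegree * ‖Polynomial.aeval (σ α) Q‖ := fun σ => by
      rw [map_mul, hσ, norm_mul, map_pow, map_intCast, norm_pow, Complex.norm_intCast,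
        abs_of_nonneg (by linarith)]
    simp only [e1] at h1
    rw [Finset.prod_mul_distrib, Finset.prod_const, Finset.card_univ] at h1
    rw [mul_pow, mul_assoc]
    refine h1.trans (mul_le_mul_of_nonneg_left ?_ (by positivity))
    -- The factor of the embedding induced by ℝ ⊂ ℂ is |Q(β)|; every other embedding moves β and
    -- contributes at most A.
    rw [← Finset.mul_prod_erase _ _ (Finset.mem_univ σ₀), mul_comm]
    have e2 : ‖Polynomial.aeval (σ₀ α) Q‖ = |Polynomial.aeval β Q| := by
      rw [← hσ, hσ₀, hmap, Complex.norm_real, Real.norm_eq_abs]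
    rw [e2]
    refine mul_le_mul_of_nonneg_right ?_ (abs_nonneg _)
    calc ∏ σ ∈ Finset.univ.erase σ₀, ‖Polynomial.aeval (σ α) Q‖
        ≤ ∏ σ ∈ (Finset.univ : Finset (ℚ⟮β⟯ →ₐ[ℚ] ℂ)).erase σ₀, A := by
          refine Finset.prod_le_prod (fun _ _ => norm_nonneg _) fun σ hs => ?_
          refine hZ _ (Finset.mem_image_of_mem _ (Finset.mem_univ σ)) fun h => ?_
          refine (Finset.mem_erase.1 hs).1 (IntermediateField.algHom_ext_of_eq_adjoin _ rfl ?_)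
          rintro y rfl
          change σ α = σ₀ α
          rw [h, hσ₀, hαβ]
      _ = A ^ (Finset.univ.erase σ₀).card := Finset.prod_const _
      _ ≤ A ^ Fintype.card (ℚ⟮β⟯ →ₐ[ℚ] ℂ) := pow_le_pow_right₀ hA (Finset.card_le_univ _)

/-- A Liouville-type bound: Q grows at most exponentially in its degree at each conjugate, so it can
be at most exponentially small at β. -/
theorem exists_le_pow_mul_abs_aeval {β : ℝ} (hβ : IsAlgebraic ℤ β) {H : ℝ} (hH : 1 ≤ H) :
    ∃ c > 0, ∃ B : ℝ, 1 ≤ B ∧ ∀ Q : Polynomial ℤ, (∀ k, |(Q.coeff k : ℝ)| ≤ H) →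
      Polynomial.aeval β Q ≠ 0 → c ≤ B ^ Q.natDegree * |Polynomial.aeval β Q| := by
  have hq : IsIntegral ℚ β := isAlgebraic_iff_isIntegral.1
    (hβ.extendScalars (RingHom.injective_int (algebraMap ℤ ℚ)))
  obtain ⟨Z, d, -, hZ⟩ := exists_one_le_mul_abs_aeval hq
  obtain ⟨L, hL0, hLint⟩ : ∃ L : ℤ, 1 ≤ L ∧ IsIntegral ℤ ((L : ℝ) * β) := by
    obtain ⟨y, hy0, hy⟩ := hβ.exists_integral_multiple
    refine ⟨|y|, Int.one_le_abs hy0, ?_⟩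
    rcases abs_choice y with h | h <;> rw [h]
    · simpa using hy
    · simpa using hy.neg
  set M : ℝ := 1 + ∑ z ∈ Z, ‖z‖ with hM
  have hM1 : 1 ≤ M := le_add_of_nonneg_right (Finset.sum_nonneg fun _ _ => norm_nonneg _)
  have hL1 : (1 : ℝ) ≤ L := by exact_mod_cast hL0
  refine ⟨(H ^ d)⁻¹, by positivity, (L * (2 * M)) ^ d, one_le_pow₀ (by nlinarith), ?_⟩
  intro Q hQ hne
  have h := hZ L hL0 hLint Q (H * (2 * M) ^ Q.natDegree)
    (one_le_mul_of_one_le_of_one_le hH (one_le_pow₀ (by linarith))) (fun z hz _ => ?_) hne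
  · rw [inv_le_iff_one_le_mul₀ (by positivity)]
    refine h.trans (le_of_eq ?_)
    rw [← pow_mul, mul_comm d, pow_mul, mul_pow (L : ℝ)]
    ring
  · refine (norm_aeval_le hQ z).trans (mul_le_mul_of_nonneg_left ?_ (by linarith))
    have hzM : ‖z‖ ≤ M := by
      have := Finset.single_le_sum (f := fun z : ℂ => ‖z‖) (fun _ _ => norm_nonneg _) hz
      linarith
    -- The number of terms is absorbed into the base, which explains 2 M in place of M.
    have h2 : (Q.natDegree + 1 : ℝ) ≤ 2 ^ Q.natDegree := by
      exact_mod_cast Nat.lt_two_pow_self (n := Q.natDegree)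
    calc ∑ i ∈ Finset.range (Q.natDegree + 1), ‖z‖ ^ i
        ≤ ∑ i ∈ Finset.range (Q.natDegree + 1), M ^ Q.natDegree := by
          refine Finset.sum_le_sum fun i hi => ?_
          exact (pow_le_pow_left₀ (norm_nonneg _) hzM i).trans
            (pow_le_pow_right₀ hM1 (Nat.lt_succ_iff.1 (Finset.mem_range.1 hi)))
      _ = (Q.natDegree + 1 : ℝ) * M ^ Q.natDegree := by simp
      _ ≤ 2 ^ Q.natDegree * M ^ Q.natDegree := mul_le_mul_of_nonneg_right h2 (by positivity)
      _ = (2 * M) ^ Q.natDegree := (mul_pow _ _ _).symm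

theorem isIntMinpoly_intMinpoly {β : ℝ} (hβ : IsAlgebraic ℤ β) :
    IsIntMinpoly β (intMinpoly β) :=
  Classical.epsilon_spec (exists_isIntMinpoly hβ)

/-- Garsia's lemma: at conjugates inside the unit disk Q is bounded by a geometric series, and no
denominator has to be cleared, so the bound does not depend on the degree. -/
theorem IsPisot.exists_le_abs_aeval {β : ℝ} (hβ : IsPisot β) {H : ℝ} (hH : 1 ≤ H) :
    ∃ c > 0, ∀ Q : Polynomial ℤ, (∀ k, |(Q.coeff k : ℝ)| ≤ H) →
      Polynomial.aeval β Q ≠ 0 → c ≤ |Polynomial.aeval β Q| := by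
  have halg : IsAlgebraic ℤ β := hβ.1.isAlgebraic
  have hP := isIntMinpoly_intMinpoly halg
  obtain ⟨Z, d, hroot, hZ⟩ := exists_one_le_mul_abs_aeval (hβ.1.tower_top (A := ℚ))
  set A : ℝ := 1 + ∑ z ∈ Z, |H / (1 - ‖z‖)| with hA
  have hA1 : 1 ≤ A := le_add_of_nonneg_right (Finset.sum_nonneg fun _ _ => abs_nonneg _)
  refine ⟨(A ^ d)⁻¹, by positivity, fun Q hQ hne => ?_⟩
  have h := hZ 1 le_rfl (by simpa using hβ.1) Q A hA1 (fun z hz hzβ => ?_) hne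
  · rw [inv_le_iff_one_le_mul₀ (by positivity)]
    refine h.trans (le_of_eq ?_)
    simp
    ring
  · have hz1 : ‖z‖ < 1 := by
      refine hβ.2 z (Finset.mem_erase.2 ⟨hzβ, ?_⟩)
      rw [Multiset.mem_toFinset, Polynomial.mem_aroots]
      exact ⟨fun h0 => by simpa [h0] using hP.2.1, hroot z hz _ hP.1⟩
    have hgeom : ∑ i ∈ Finset.range (Q.natDegree + 1), ‖z‖ ^ i ≤ (1 - ‖z‖)⁻¹ := by
      rw [← tsum_geometric_of_lt_one (norm_nonneg _) hz1]
      exact (summable_geometric_of_lt_one (norm_nonneg _) hz1).sum_le_tsum _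
        fun _ _ => by positivity
    have h1 := Finset.single_le_sum (f := fun z : ℂ => |H / (1 - ‖z‖)|)
      (fun _ _ => abs_nonneg _) hz
    have h2 := le_abs_self (H / (1 - ‖z‖))
    have h3 := (norm_aeval_le hQ z).trans (mul_le_mul_of_nonneg_left hgeom (by linarith))
    rw [← div_eq_mul_inv] at h3
    linarith

/-- This makes the linear term of the first bound nonnegative. -/
theorem one_le_leadCoeff_mul_outerProduct {β : ℝ} (hβ : IsAlgebraic ℤ β) :
    1 ≤ (leadCoeff β : ℝ) * outerProduct β := by
  have h1 : (1 : ℝ) ≤ leadCoeff β := by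
    exact_mod_cast (isIntMinpoly_intMinpoly hβ).2.1
  have h2 : 1 ≤ outerProduct β :=
    Finset.prod_induction _ (1 ≤ ·) (fun _ _ => one_le_mul_of_one_le_of_one_le) le_rfl
      fun z hz => (Finset.mem_filter.1 hz).2.le
  nlinarith

/-! ### The decoding algorithm -/

/-- `∑_{k < i} x_k b^{m-1-k} D^k`, for a word `x` of length `m`. -/
def prefixSum {R : Type*} [CommSemiring R] (x : List Bool) (b D : R) (i : ℕ) : R :=
  ∑ k ∈ Finset.range i, ((x.getD k false).toNat : R) * (b ^ (x.length - 1 - k) * D ^ k)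

/-- The endpoint, in homogeneous coordinates `β = b / D` and scaled by `(β - 1) β ^ m`, of the
interval of those `s` whose `i`-th remainder is in the switch region, given that `s` has an
expansion that begins with the word `x` of length `m`: the left endpoint if `x_i = 0`, the right one
if `x_i = 1`. For `i = m` it is the least `s` that has such an expansion. -/
def threshold {R : Type*} [CommSemiring R] [Sub R] (x : List Bool) (b D : R) (i : ℕ) : R :=
  (b - D) * prefixSum x b D i +
    if i < x.length then cond (x.getD i false) D (b - D) * (b ^ (x.length - 1 - i) * D ^ i) else 0

/-- The word of the `n` least significant binary digits of `Y`, most significant digit first. -/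
def binaryWord (n Y : ℕ) : List Bool :=
  (List.range n).map fun i => decide (Y / 2 ^ (n - 1 - i) % 2 = 1)

/-- The subsequence of the letters of `x` at positions `i` with `c i (x i)`. -/
def selectWord (c : ℕ → Bool → Bool) (x : List Bool) : List Bool :=
  (List.range x.length).filterMap fun i =>
    cond (c i (x.getD i false)) (some (x.getD i false)) none

/-- Whether the `i`-th threshold for `β = b / D` is, up to a tolerance `2⁻ᵉ`, at most the
`(m - a.1)`-th one plus `a.2 2⁻ᵉ`. -/
def cutTest (x : List Bool) (b D e : ℕ) (a : ℕ × ℕ) (i : ℕ) : Bool :=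
  decide (2 ^ e * threshold x b D i + D ^ x.length ≤
    2 ^ e * threshold x b D (x.length - a.1) + a.2 * D ^ x.length)

/-- The largest `n ≤ m` with `2 ^ n ≤ (b / D) ^ m`. -/
def binaryLength (m b D : ℕ) : ℕ :=
  Nat.findGreatest (fun k => 2 ^ k * D ^ m ≤ b ^ m) m

/-- The decoded pair of a binary expansion and of a word of coin tosses, from a prefix `x` of a
`β`-expansion for `β = b / D`, a precision `e`, and advice `a`. -/
def decodeWith (x : List Bool) (b D e : ℕ) (a : (ℕ × ℕ) × (ℕ × ℕ) × (ℕ × ℕ)) : List Bool :=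
  pair
    (binaryWord (binaryLength x.length b D + a.2.2.1)
      (2 ^ (binaryLength x.length b D + a.2.2.1) * D * prefixSum x b D x.length / b ^ x.length
        -- The correction to the approximate integer is signed; the shift by 4 keeps the advice in
        -- ℕ.
        + a.2.2.2 - 4))
    -- Two cuts are needed: a digit 0 asks for threshold ≤ s, a digit 1 for the negation of
    -- threshold < s, and these differ when s is itself a threshold.
    (selectWord (fun i c => cond c (!cutTest x b D e a.2.1 i) (cutTest x b D e a.1 i)) x)

/-- The number of binary digits of `β` used for words of length `m`, with precision
`c₁ m + c₀`. -/
def digits (c₁ c₀ m : ℕ) : ℕ :=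
  c₁ * m + c₀ + 2 * m + 10

/-- The decoding algorithm, with precision `c₁ m + c₀` for words of length `m`. -/
noncomputable def decode (β : ℝ) (c₁ c₀ : ℕ) (x : List Bool) (a : ℕ) : List Bool :=
  decodeWith x ⌊β * 2 ^ digits c₁ c₀ x.length⌋₊ (2 ^ digits c₁ c₀ x.length)
    (c₁ * x.length + c₀)
    (Denumerable.ofNat ((ℕ × ℕ) × (ℕ × ℕ) × (ℕ × ℕ)) a)

/-! ### Primitive recursiveness of the decoder -/

section Primrec

variable {α : Type*} [Primcodable α]

theorem primrec_getD_false {x : α → List Bool} {i : α → ℕ} (hx : Primrec x) (hi : Primrec i) :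
    Primrec fun a => (x a).getD (i a) false :=
  (Primrec.list_getD false).comp hx hi

theorem primrec_prefixSum {x : α → List Bool} {b D i : α → ℕ} (hx : Primrec x)
    (hb : Primrec b) (hD : Primrec D) (hi : Primrec i) :
    Primrec fun a => prefixSum (x a) (b a) (D a) (i a) := by
  refine primrec_sum_range (f := fun a k =>
    ((x a).getD k false).toNat * (b a ^ ((x a).length - 1 - k) * D a ^ k)) ?_ hi
  have hx' := hx.comp (Primrec.fst (α := α) (β := ℕ))
  refine Primrec.nat_mul.comp ((Primrec.dom_bool Bool.toNat).comp
    (primrec_getD_false hx' Primrec.snd)) (Primrec.nat_mul.comp ?_ ?_)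
  · exact primrec_pow.comp (hb.comp Primrec.fst) (Primrec.nat_sub.comp
      (Primrec.nat_sub.comp (Primrec.list_length.comp hx') (Primrec.const 1)) Primrec.snd)
  · exact primrec_pow.comp (hD.comp Primrec.fst) Primrec.snd

theorem primrec_threshold {x : α → List Bool} {b D i : α → ℕ} (hx : Primrec x)
    (hb : Primrec b) (hD : Primrec D) (hi : Primrec i) :
    Primrec fun a => threshold (x a) (b a) (D a) (i a) := by
  have hl := Primrec.list_length.comp hx
  refine Primrec.nat_add.comp (Primrec.nat_mul.comp (Primrec.nat_sub.comp hb hD)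
    (primrec_prefixSum hx hb hD hi)) (Primrec.ite (PrimrecRel.comp Primrec.nat_lt hi hl)
      (Primrec.nat_mul.comp ?_ (Primrec.nat_mul.comp ?_ (primrec_pow.comp hD hi)))
      (Primrec.const 0))
  · exact Primrec.cond (primrec_getD_false hx hi) hD (Primrec.nat_sub.comp hb hD)
  · exact primrec_pow.comp hb (Primrec.nat_sub.comp
      (Primrec.nat_sub.comp hl (Primrec.const 1)) hi)

theorem primrec_binaryWord : Primrec₂ binaryWord := by
  refine Primrec.list_map (g := fun (p : ℕ × ℕ) i => decide (p.2 / 2 ^ (p.1 - 1 - i) % 2 = 1))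
    (Primrec.list_range.comp Primrec.fst) ?_
  have hn : Primrec fun q : (ℕ × ℕ) × ℕ => q.1.1 - 1 - q.2 :=
    Primrec.nat_sub.comp (Primrec.nat_sub.comp (Primrec.fst.comp Primrec.fst)
      (Primrec.const 1)) Primrec.snd
  exact (PrimrecRel.comp Primrec.eq (Primrec.nat_mod.comp (Primrec.nat_div.comp
    (Primrec.snd.comp Primrec.fst) (primrec_pow.comp (Primrec.const 2) hn)) (Primrec.const 2))
    (Primrec.const 1)).decide.to₂

theorem primrec_selectWord {c : α → ℕ → Bool → Bool} {x : α → List Bool}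
    (hc : Primrec fun p : α × ℕ × Bool => c p.1 p.2.1 p.2.2) (hx : Primrec x) :
    Primrec fun a => selectWord (c a) (x a) := by
  refine Primrec.listFilterMap (g := fun a i => cond (c a i ((x a).getD i false))
    (some ((x a).getD i false)) none) (Primrec.list_range.comp (Primrec.list_length.comp hx)) ?_
  have hg : Primrec fun p : α × ℕ => (x p.1).getD p.2 false :=
    primrec_getD_false (hx.comp Primrec.fst) Primrec.snd
  exact Primrec.cond (hc.comp (Primrec.pair Primrec.fst (Primrec.pair Primrec.snd hg)))
    (Primrec.option_some.comp hg) (Primrec.const none)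

theorem primrec_cutTest {x : α → List Bool} {b D e i : α → ℕ} {p : α → ℕ × ℕ}
    (hx : Primrec x) (hb : Primrec b) (hD : Primrec D) (he : Primrec e) (hp : Primrec p)
    (hi : Primrec i) : Primrec fun a => cutTest (x a) (b a) (D a) (e a) (p a) (i a) := by
  have hl := Primrec.list_length.comp hx
  have hDm := primrec_pow.comp hD hl
  have he2 := primrec_pow.comp (Primrec.const 2) he
  exact (PrimrecRel.comp Primrec.nat_le
    (Primrec.nat_add.comp (Primrec.nat_mul.comp he2 (primrec_threshold hx hb hD hi)) hDm)
    (Primrec.nat_add.comp (Primrec.nat_mul.comp he2 (primrec_threshold hx hb hD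
      (Primrec.nat_sub.comp hl (Primrec.fst.comp hp))))
      (Primrec.nat_mul.comp (Primrec.snd.comp hp) hDm))).decide

theorem primrec_binaryLength {m b D : α → ℕ} (hm : Primrec m) (hb : Primrec b)
    (hD : Primrec D) : Primrec fun a => binaryLength (m a) (b a) (D a) := by
  refine Primrec.nat_findGreatest hm (p := fun a k => 2 ^ k * D a ^ m a ≤ b a ^ m a) ?_
  exact PrimrecRel.comp Primrec.nat_le
    (Primrec.nat_mul.comp (primrec_pow.comp (Primrec.const 2) Primrec.snd)
      (primrec_pow.comp (hD.comp Primrec.fst) (hm.comp Primrec.fst)))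
    (primrec_pow.comp (hb.comp Primrec.fst) (hm.comp Primrec.fst))

theorem primrec_decodeWith {x : α → List Bool} {b D e : α → ℕ}
    {p : α → (ℕ × ℕ) × (ℕ × ℕ) × (ℕ × ℕ)} (hx : Primrec x) (hb : Primrec b) (hD : Primrec D)
    (he : Primrec e) (hp : Primrec p) :
    Primrec fun a => decodeWith (x a) (b a) (D a) (e a) (p a) := by
  have hl := Primrec.list_length.comp hx
  have h1 := Primrec.fst.comp hp
  have h2 := Primrec.fst.comp (Primrec.snd.comp hp)
  have h3 := Primrec.snd.comp (Primrec.snd.comp hp)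
  have hn := Primrec.nat_add.comp (primrec_binaryLength hl hb hD) (Primrec.fst.comp h3)
  refine primrec_pair.comp (primrec_binaryWord.comp hn ?_) (primrec_selectWord
    (c := fun a i c => cond c (!cutTest (x a) (b a) (D a) (e a) (p a).2.1 i)
      (cutTest (x a) (b a) (D a) (e a) (p a).1 i)) ?_ hx)
  · exact Primrec.nat_sub.comp (Primrec.nat_add.comp (Primrec.nat_div.comp
      (Primrec.nat_mul.comp (Primrec.nat_mul.comp (primrec_pow.comp (Primrec.const 2) hn) hD)
        (primrec_prefixSum hx hb hD hl)) (primrec_pow.comp hb hl)) (Primrec.snd.comp h3))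
      (Primrec.const 4)
  · have f : Primrec (Prod.fst : α × ℕ × Bool → α) := Primrec.fst
    have g : Primrec fun q : α × ℕ × Bool => q.2.1 := Primrec.fst.comp Primrec.snd
    exact Primrec.cond (Primrec.snd.comp Primrec.snd)
      (Primrec.not.comp (primrec_cutTest (hx.comp f) (hb.comp f) (hD.comp f) (he.comp f)
        (h2.comp f) g))
      (primrec_cutTest (hx.comp f) (hb.comp f) (hD.comp f) (he.comp f) (h1.comp f) g)

end Primrec

theorem primrec_decode {β : ℝ} (h0 : 0 ≤ β) (hβ : IsAlgebraic ℤ β) (c₁ c₀ : ℕ) :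
    Primrec₂ (decode β c₁ c₀) := by
  have hl : Primrec fun p : List Bool × ℕ => p.1.length :=
    Primrec.list_length.comp Primrec.fst
  have he : Primrec fun p : List Bool × ℕ => c₁ * p.1.length + c₀ :=
    Primrec.nat_add.comp (Primrec.nat_mul.comp (Primrec.const c₁) hl) (Primrec.const c₀)
  have hN : Primrec fun p : List Bool × ℕ => digits c₁ c₀ p.1.length :=
    Primrec.nat_add.comp (Primrec.nat_add.comp he
      (Primrec.nat_mul.comp (Primrec.const 2) hl)) (Primrec.const 10)
  exact primrec_decodeWith Primrec.fst ((primrec_floor_mul_two_pow h0 hβ).comp hN)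
    (primrec_pow.comp (Primrec.const 2) hN) he ((Primrec.ofNat _).comp Primrec.snd)

/-! ### Remainders and coin tosses -/

theorem length_take (x : ℕ → Bool) (n : ℕ) : (take x n).length = n := by
  simp [take]

theorem getD_take {x : ℕ → Bool} {n i : ℕ} (hi : i < n) : (take x n).getD i false = x i := by
  simp [take, hi]

theorem nonneg_of_mem_expansions {β s : ℝ} (hβ : 1 < β) {x : ℕ → Bool}
    (hx : x ∈ expansions β s) : 0 ≤ s :=
  HasSum.nonneg (fun i => by positivity) hx

theorem le_of_mem_expansions {β s : ℝ} (hβ : 1 < β) {x : ℕ → Bool}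
    (hx : x ∈ expansions β s) : s ≤ (β - 1)⁻¹ := by
  have h0 : (0 : ℝ) < β := by linarith
  have hg := (hasSum_geometric_of_lt_one (inv_nonneg.2 h0.le) (inv_lt_one_of_one_lt₀ hβ)).mul_left
    β⁻¹
  have e : β⁻¹ * (1 - β⁻¹)⁻¹ = (β - 1)⁻¹ := by
    rw [← mul_inv, mul_sub, mul_one, mul_inv_cancel₀ h0.ne']
  rw [e] at hg
  refine hasSum_le (fun i => ?_) hx hg
  rw [pow_succ']
  exact mul_le_of_le_one_left (by positivity) (by exact_mod_cast Bool.toNat_le _)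

/-- The remainder before the `i`-th step of an algorithm that emits the bits `x` of a
`β`-expansion of `s`. -/
noncomputable def remainder (β s : ℝ) (x : ℕ → Bool) : ℕ → ℝ
  | 0 => s
  | i + 1 => β * remainder β s x i - ((x i).toNat : ℝ)

theorem remainder_tail (β s : ℝ) (x : ℕ → Bool) (i : ℕ) :
    remainder β (β * s - ((x 0).toNat : ℝ)) (fun k => x (k + 1)) i = remainder β s x (i + 1) := by
  induction i with
  | zero => rfl
  | succ i ih => rw [remainder, ih, remainder.eq_2 β s x (i + 1)]

theorem tail_mem_expansions {β s : ℝ} (hβ : β ∈ Set.Ioo (1 : ℝ) 2) {x : ℕ → Bool}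
    (hx : x ∈ expansions β s) (i : ℕ) :
    (fun k => x (k + i)) ∈ expansions β (remainder β s x i) := by
  induction i with
  | zero => exact hx
  | succ i ih =>
    have h := (expansions_cons hβ ih).1
    simp only [zero_add, Nat.add_right_comm _ 1 i] at h
    exact h

/-- Inside the switch region the toss read must equal the digit; outside, the digit is forced and no
toss is read. The indicator `c` is arbitrary so that the decoder's test can be substituted for it.
-/
theorem isCoinTossWord_filterMap {β s : ℝ} (hβ : β ∈ Set.Ioo (1 : ℝ) 2) {x : ℕ → Bool}
    (hx : x ∈ expansions β s) (c : ℕ → Bool) (n : ℕ)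
    (hc : ∀ i < n, (c i = true ↔ remainder β s x i ∈ switchRegion β)) :
    IsCoinTossWord β s (take x n)
      ((List.range n).filterMap fun i => cond (c i) (some (x i)) none) := by
  induction n generalizing s x c with
  | zero => simp [IsCoinTossWord, take, randomExpansion]
  | succ n ih =>
    obtain ⟨hx', ht, hf⟩ := expansions_cons hβ hx
    have hw := ih hx' (fun i => c (i + 1)) fun i hi => by
      rw [remainder_tail]
      exact hc (i + 1) (by omega)
    have hc0 := hc 0 (by omega)
    simp only [remainder] at hc0
    rw [List.range_succ_eq_map, List.filterMap_cons, List.filterMap_map]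
    set w := (List.range n).filterMap fun i => cond (c (i + 1)) (some (x (i + 1))) none with hw_def
    have hcomp : (fun i => cond (c i) (some (x i)) none) ∘ Nat.succ =
        fun i => cond (c (i + 1)) (some (x (i + 1))) none := rfl
    rw [hcomp, ← hw_def]
    simp only [IsCoinTossWord, length_take, Set.ext_iff, Set.mem_ofPred_eq] at hw
    by_cases hs : s ∈ switchRegion β
    · have hbit : ∀ t, nextBit β s t = t 0 := fun t => by
        rw [nextBit, if_neg (not_lt.2 hs.1), if_neg (not_lt.2 hs.2)]
      rw [hc0.2 hs]
      simp only [IsCoinTossWord, Set.ext_iff, Set.mem_ofPred_eq, cond_true]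
      intro t
      rw [take_succ x, List.length_cons, length_take, randomExpansion_succ, hbit,
        List.length_cons, take_succ t, List.cons_eq_cons, List.cons_eq_cons]
      refine and_congr_right fun h => ?_
      rw [← hw]
      simp [randomStep, hs, hbit, h]
    · have hbit : ∀ t, nextBit β s t = x 0 := fun t => by
        unfold nextBit
        cases hb : x 0
        · have := hf hb
          by_cases h : s < β⁻¹
          · simp [h]
          · exact absurd ⟨not_lt.1 h, this⟩ hs
        · have := ht hb
          by_cases h : ((β - 1) * β)⁻¹ < s
          · rw [if_neg (not_lt.2 this), if_pos h]
          · exact absurd ⟨this, not_lt.1 h⟩ hs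
      rw [Bool.eq_false_iff.2 fun h => hs (hc0.1 h)]
      simp only [IsCoinTossWord, Set.ext_iff, Set.mem_ofPred_eq, cond_false]
      intro t
      rw [take_succ x, List.length_cons, length_take, randomExpansion_succ, hbit,
        List.cons_eq_cons, ← hw]
      simp [randomStep, hs, hbit]

theorem coinTossWord_eq_selectWord {β s : ℝ} (hβ : β ∈ Set.Ioo (1 : ℝ) 2) {x : ℕ → Bool}
    (hx : x ∈ expansions β s) {c : ℕ → Bool → Bool} {n : ℕ}
    (hc : ∀ i < n, (c i (x i) = true ↔ remainder β s x i ∈ switchRegion β)) :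
    coinTossWord β s (take x n) = selectWord c (take x n) := by
  have h1 := isCoinTossWord_filterMap hβ hx (fun i => c i (x i)) n hc
  have h2 : IsCoinTossWord β s (take x n) (coinTossWord β s (take x n)) :=
    Classical.epsilon_spec ⟨_, h1⟩
  rw [h2.unique h1, selectWord, length_take]
  refine List.filterMap_congr fun i hi => ?_
  rw [getD_take (List.mem_range.1 hi)]

theorem prefixSum_take {β : ℝ} (x : ℕ → Bool) {m i : ℕ} (hi : i ≤ m) :
    prefixSum (take x m) β 1 i = ∑ k ∈ Finset.range i, ((x k).toNat : ℝ) * β ^ (m - 1 - k) := by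
  refine Finset.sum_congr rfl fun k hk => ?_
  rw [getD_take ((Finset.mem_range.1 hk).trans_le hi), length_take, one_pow, mul_one]

theorem pow_mul_remainder (β s : ℝ) (x : ℕ → Bool) {m i : ℕ} (hi : i ≤ m) :
    β ^ (m - i) * remainder β s x i = β ^ m * s - prefixSum (take x m) β 1 i := by
  rw [prefixSum_take x hi]
  induction i with
  | zero => simp [remainder]
  | succ i ih =>
    obtain ⟨j, rfl⟩ := Nat.exists_eq_add_of_le hi
    have h := ih (by omega)
    rw [show i + 1 + j - i = j + 1 by omega, pow_succ] at h
    rw [Finset.sum_range_succ, show i + 1 + j - (i + 1) = j by omega,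
      show i + 1 + j - 1 - i = j by omega, remainder]
    linear_combination h

/-- A digit 1 forces the remainder to be at least the left end of the region, a digit 0 at most the
right end. The inequality left over is rescaled by the positive factor (β - 1) β^{m-i}. -/
theorem mem_switchRegion_iff {β s : ℝ} (hβ : β ∈ Set.Ioo (1 : ℝ) 2) {x : ℕ → Bool}
    (hx : x ∈ expansions β s) {m i : ℕ} (hi : i < m) :
    remainder β s x i ∈ switchRegion β ↔
      if x i = true then ¬ threshold (take x m) β 1 i < (β - 1) * β ^ m * s
      else threshold (take x m) β 1 i ≤ (β - 1) * β ^ m * s := by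
  have h1 : (0 : ℝ) < β - 1 := sub_pos.2 hβ.1
  have h0 : (0 : ℝ) < β := by linarith
  obtain ⟨-, ht, hf⟩ := expansions_cons hβ (tail_mem_expansions hβ hx i)
  rw [zero_add] at ht hf
  have hr := pow_mul_remainder β s x hi.le
  rw [show m - i = m - 1 - i + 1 by omega, pow_succ] at hr
  set r := remainder β s x i
  set p := β ^ (m - 1 - i) with hp
  have hp0 : 0 < p := by positivity
  have hthr : threshold (take x m) β 1 i - (β - 1) * β ^ m * s =
      p * (cond (x i) 1 (β - 1) - (β - 1) * β * r) := by
    rw [threshold, length_take, if_pos hi, getD_take hi, one_pow, mul_one, ← hp]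
    linear_combination (β - 1) * hr
  rw [← sub_neg, ← sub_nonpos (a := threshold _ _ _ _), hthr]
  cases hxi : x i
  · have hr2 := hf hxi
    have e : r ∈ switchRegion β ↔ β⁻¹ ≤ r := ⟨fun h => h.1, fun h => ⟨h, hr2⟩⟩
    rw [e, inv_le_iff_one_le_mul₀ h0]
    simp only [Bool.false_eq_true, if_false, cond_false]
    rw [show p * (β - 1 - (β - 1) * β * r) = p * (β - 1) * (1 - r * β) by ring,
      mul_nonpos_iff_pos_imp_nonpos, sub_nonpos]
    have hp1 : 0 < p * (β - 1) := by positivity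
    exact ⟨fun h => ⟨fun _ => h, fun _ => hp1.le⟩, fun h => h.1 hp1⟩
  · have hr2 := ht hxi
    have e : r ∈ switchRegion β ↔ r ≤ ((β - 1) * β)⁻¹ := ⟨fun h => h.2, fun h => ⟨hr2, h⟩⟩
    rw [e, ← one_div, le_div_iff₀ (by positivity)]
    simp only [if_true, cond_true, not_lt]
    rw [mul_nonneg_iff_of_pos_left hp0]
    constructor <;> intro h <;> linarith

theorem threshold_length_take (β : ℝ) (x : ℕ → Bool) (m : ℕ) :
    threshold (take x m) β 1 m = (β - 1) * prefixSum (take x m) β 1 m := by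
  simp [threshold, length_take]

/-- The remainder after m steps is in [0, 1/(β - 1)], and the scaling multiplies it by β - 1. -/
theorem threshold_length_le {β s : ℝ} (hβ : β ∈ Set.Ioo (1 : ℝ) 2) {x : ℕ → Bool}
    (hx : x ∈ expansions β s) (m : ℕ) :
    threshold (take x m) β 1 m ≤ (β - 1) * β ^ m * s ∧
      (β - 1) * β ^ m * s ≤ threshold (take x m) β 1 m + 1 := by
  have h1 : (0 : ℝ) < β - 1 := sub_pos.2 hβ.1
  have hr := pow_mul_remainder β s x (le_refl m)
  rw [Nat.sub_self, pow_zero, one_mul] at hr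
  have hm := tail_mem_expansions hβ hx m
  have hr0 := nonneg_of_mem_expansions hβ.1 hm
  have hr1 := le_of_mem_expansions hβ.1 hm
  rw [← one_div, le_div_iff₀ h1] at hr1
  rw [threshold_length_take]
  constructor
  · have : 0 ≤ (β - 1) * remainder β s x m := by positivity
    rw [hr] at this
    linarith
  · rw [hr] at hr1
    linarith

/-! ### Greedy binary expansions -/

/-- The error 1 is attained at s = 1, whose greedy digits are all 1. -/
theorem exists_take_greedyBinary (n : ℕ) {s : ℝ} (hs : s ∈ Set.Icc (0 : ℝ) 1) :
    ∃ Y : ℕ, Y < 2 ^ n ∧ |2 ^ n * s - Y| ≤ 1 ∧ take (greedyBinary s) n = binaryWord n Y := by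
  induction n generalizing s with
  | zero =>
    refine ⟨0, by simp, ?_, rfl⟩
    rw [abs_le]
    constructor <;> simp <;> linarith [hs.1, hs.2]
  | succ n ih =>
    have hcases : ∃ b : Bool, greedyBinary s 0 = b ∧ greedyStep s = 2 * s - b.toNat ∧
        greedyStep s ∈ Set.Icc (0 : ℝ) 1 := by
      by_cases h : s < 1 / 2
      · exact ⟨false, if_pos h, by rw [greedyStep, if_pos h, Bool.toNat_false, Nat.cast_zero], by
            rw [greedyStep, if_pos h]; constructor <;> linarith [hs.1]⟩
      · exact ⟨true, if_neg h, by rw [greedyStep, if_neg h, Bool.toNat_true, Nat.cast_one], by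
            rw [greedyStep, if_neg h]; constructor <;> linarith [hs.2]⟩
    obtain ⟨b, hb, hstep, hmem⟩ := hcases
    obtain ⟨Y, hY, habs, htake⟩ := ih hmem
    refine ⟨b.toNat * 2 ^ n + Y, ?_, ?_, ?_⟩
    · have := Bool.toNat_le b
      rw [pow_succ]
      nlinarith
    · rw [hstep] at habs
      push_cast
      convert habs using 2
      ring
    · have htail : (fun i => greedyBinary s (i + 1)) = greedyBinary (greedyStep s) := by
        ext i
        simp [greedyBinary, Function.iterate_succ_apply]
      rw [take_succ, hb, htail, htake]
      simp only [binaryWord, List.range_succ_eq_map, List.map_cons, List.map_map]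
      congr 1
      · rw [show n + 1 - 1 - 0 = n by omega, Nat.mul_comm, Nat.mul_add_div (by positivity),
          Nat.div_eq_of_lt hY]
        cases b <;> simp
      · refine List.map_congr_left fun i hi => ?_
        have hi' := List.mem_range.1 hi
        have e : 2 ^ n = 2 ^ (n - 1 - i) * (2 * 2 ^ i) := by
          rw [← pow_succ', ← pow_add]
          congr 1
          omega
        simp only [Function.comp_apply]
        rw [show n + 1 - 1 - i.succ = n - 1 - i by omega, e,
          show b.toNat * (2 ^ (n - 1 - i) * (2 * 2 ^ i)) + Y =
            2 ^ (n - 1 - i) * (2 * (b.toNat * 2 ^ i)) + Y by ring,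
          Nat.mul_add_div (by positivity), Nat.mul_add_mod]

section Thresholds

/-! ### Thresholds as integer polynomials -/

open Polynomial

/-- The same expressions live in ℕ for the algorithm, in ℝ for the analysis and in ℤ[X] for degree
and coefficient bounds; ring homomorphisms carry one to another. -/
theorem map_prefixSum {R S : Type*} [CommSemiring R] [CommSemiring S] (f : R →+* S)
    (x : List Bool) (b D : R) (i : ℕ) :
    f (prefixSum x b D i) = prefixSum x (f b) (f D) i := by
  simp [prefixSum, map_sum]

theorem map_threshold {R S : Type*} [CommRing R] [CommRing S] (f : R →+* S)
    (x : List Bool) (b D : R) (i : ℕ) :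
    f (threshold x b D i) = threshold x (f b) (f D) i := by
  unfold threshold
  split_ifs <;> cases x.getD i false <;> simp [map_prefixSum]

/-- The `i`-th threshold as a polynomial in `β`. -/
noncomputable def thresholdPoly (x : List Bool) (i : ℕ) : ℤ[X] :=
  threshold x X 1 i

theorem aeval_thresholdPoly (x : List Bool) (i : ℕ) (y : ℝ) :
    aeval y (thresholdPoly x i) = threshold x y 1 i := by
  have := map_threshold (aeval (R := ℤ) y).toRingHom x X 1 i
  simpa [thresholdPoly] using this

/-- The exponents m - 1 - k with k < m are distinct, so each coefficient is 0 or a single bit. -/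
theorem coeff_prefixSum {x : List Bool} {i : ℕ} (hi : i ≤ x.length) (j : ℕ) :
    0 ≤ (prefixSum x (X : ℤ[X]) 1 i).coeff j ∧ (prefixSum x (X : ℤ[X]) 1 i).coeff j ≤ 1 := by
  have e : (prefixSum x (X : ℤ[X]) 1 i).coeff j = ∑ k ∈ Finset.range i,
      if x.length - 1 - k = j then ((x.getD k false).toNat : ℤ) else 0 := by
    rw [prefixSum, finsetSum_coeff]
    refine Finset.sum_congr rfl fun k _ => ?_
    rw [one_pow, mul_one, ← C_eq_natCast, coeff_C_mul, coeff_X_pow]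
    simp [eq_comm]
  rw [e]
  constructor
  · exact Finset.sum_nonneg fun k _ => by split_ifs <;> positivity
  · calc _ ≤ ∑ k ∈ Finset.range i, if k = x.length - 1 - j then (1 : ℤ) else 0 := by
          refine Finset.sum_le_sum fun k hk => ?_
          have hk' := Finset.mem_range.1 hk
          have hb : ((x.getD k false).toNat : ℤ) ≤ 1 := by exact_mod_cast Bool.toNat_le _
          by_cases h : x.length - 1 - k = j
          · rw [if_pos h, if_pos (by omega)]
            exact hb
          · rw [if_neg h]
            split_ifs <;> norm_num
      _ ≤ 1 := by
          rw [Finset.sum_ite_eq']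
          split_ifs <;> norm_num

theorem natDegree_prefixSum_le (x : List Bool) (i : ℕ) :
    (prefixSum x (X : ℤ[X]) 1 i).natDegree ≤ x.length - 1 := by
  refine natDegree_sum_le_of_forall_le _ _ fun k _ => ?_
  rw [one_pow, mul_one, ← C_eq_natCast]
  exact (natDegree_C_mul_X_pow_le _ _).trans (by omega)

theorem coeff_X_sub_one_mul (P : ℤ[X]) (j : ℕ) :
    ((X - 1) * P).coeff j = (if j = 0 then 0 else P.coeff (j - 1)) - P.coeff j := by
  rw [sub_mul, one_mul, coeff_sub]
  cases j <;> simp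

theorem abs_coeff_thresholdPoly_le {x : List Bool} {i : ℕ} (hi : i ≤ x.length) (j : ℕ) :
    |(thresholdPoly x i).coeff j| ≤ 3 := by
  have h1 : |((X - 1) * prefixSum x (X : ℤ[X]) 1 i).coeff j| ≤ 1 := by
    rw [coeff_X_sub_one_mul, abs_le]
    have ha := coeff_prefixSum hi j
    have hb := coeff_prefixSum hi (j - 1)
    split_ifs <;> omega
  have h2 : |(if i < x.length then cond (x.getD i false) 1 (X - 1) *
      (X ^ (x.length - 1 - i) * 1 ^ i) else 0 : ℤ[X]).coeff j| ≤ 1 := by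
    split_ifs
    · cases x.getD i false
      · rw [cond_false, coeff_X_sub_one_mul, one_pow, mul_one, coeff_X_pow, coeff_X_pow, abs_le]
        split_ifs <;> omega
      · rw [cond_true, one_mul, one_pow, mul_one, coeff_X_pow]
        split_ifs <;> simp
    · simp
  rw [thresholdPoly, threshold, coeff_add]
  exact (abs_add_le _ _).trans (by omega)

theorem natDegree_thresholdPoly_le {x : List Bool} (i : ℕ) :
    (thresholdPoly x i).natDegree ≤ x.length := by
  have h1 : (X - 1 : ℤ[X]).natDegree ≤ 1 := by
    simpa using natDegree_X_sub_C_le (1 : ℤ)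
  rcases Nat.eq_zero_or_pos x.length with h0 | h0
  · rw [List.length_eq_zero_iff] at h0
    subst h0
    have : prefixSum [] (X : ℤ[X]) 1 i = 0 := Finset.sum_eq_zero fun k _ => by simp
    simp [thresholdPoly, threshold, this]
  · refine natDegree_add_le_of_degree_le ?_ ?_
    · exact (natDegree_mul_le_of_le h1 (natDegree_prefixSum_le x i)).trans (by omega)
    · split_ifs
      · refine (natDegree_mul_le_of_le (m := 1) (n := x.length - 1) ?_ ?_).trans (by omega)
        · cases x.getD i false
          · exact h1
          · simp
        · rw [one_pow, mul_one]
          exact (natDegree_X_pow_le _).trans (by omega)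
      · simp

/-- The base 4 absorbs the factor k of the derivative bound k 2^{k-1}. -/
theorem pow_sub_pow_le {a b : ℝ} (ha : 0 ≤ a) (hab : a ≤ b) (hb : b ≤ 2) (k : ℕ) :
    b ^ k - a ^ k ≤ 4 ^ k * (b - a) := by
  induction k with
  | zero => simpa using hab
  | succ k ih =>
    have h1 : a ^ k ≤ 4 ^ k := pow_le_pow_left₀ ha (by linarith) k
    have h2 : b ^ (k + 1) - a ^ (k + 1) = b * (b ^ k - a ^ k) + a ^ k * (b - a) := by ring
    have h3 : 0 ≤ b ^ k - a ^ k := sub_nonneg.2 (pow_le_pow_left₀ ha hab k)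
    have h4 : 0 ≤ b - a := sub_nonneg.2 hab
    have h5 : (0 : ℝ) < 4 ^ k := by positivity
    rw [h2, pow_succ]
    nlinarith [mul_le_mul_of_nonneg_right h1 h4, mul_le_mul_of_nonneg_right hb h3,
      mul_nonneg h5.le h4]

theorem abs_aeval_sub_aeval_le {Q : ℤ[X]} {H : ℝ} (hQ : ∀ k, |(Q.coeff k : ℝ)| ≤ H) {m : ℕ}
    (hm : Q.natDegree ≤ m) {a b : ℝ} (ha : 0 ≤ a) (hab : a ≤ b) (hb : b ≤ 2) :
    |aeval a Q - aeval b Q| ≤ H * 4 ^ (m + 1) * (b - a) := by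
  have hH : 0 ≤ H := (abs_nonneg _).trans (hQ 0)
  rw [aeval_eq_sum_range' (n := m + 1) (by omega), aeval_eq_sum_range' (n := m + 1) (by omega),
    ← Finset.sum_sub_distrib]
  have h4 : ∑ k ∈ Finset.range (m + 1), (4 : ℝ) ^ k ≤ 4 ^ (m + 1) := by
    rw [geom_sum_eq (by norm_num)]
    have : (0 : ℝ) < 4 ^ (m + 1) := by positivity
    rw [div_le_iff₀ (by norm_num)]
    linarith
  calc _ ≤ ∑ k ∈ Finset.range (m + 1), H * (4 ^ k * (b - a)) := by
        refine (Finset.abs_sum_le_sum_abs _ _).trans (Finset.sum_le_sum fun k _ => ?_)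
        rw [zsmul_eq_mul, zsmul_eq_mul, ← mul_sub, abs_mul, abs_sub_comm,
          abs_of_nonneg (sub_nonneg.2 (pow_le_pow_left₀ ha hab k))]
        exact mul_le_mul (hQ k) (pow_sub_pow_le ha hab hb k)
          (sub_nonneg.2 (pow_le_pow_left₀ ha hab k)) hH
    _ = H * (∑ k ∈ Finset.range (m + 1), (4 : ℝ) ^ k) * (b - a) := by
        rw [← Finset.mul_sum, ← Finset.sum_mul]
        ring
    _ ≤ _ := mul_le_mul_of_nonneg_right (mul_le_mul_of_nonneg_left h4 hH) (sub_nonneg.2 hab)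

/-! ### From homogeneous integer thresholds to real ones -/

theorem prefixSum_cast (x : List Bool) (b D i : ℕ) :
    ((prefixSum x b D i : ℕ) : ℝ) = prefixSum x (b : ℝ) D i :=
  map_prefixSum (Nat.castRingHom ℝ) x b D i

theorem threshold_cast (x : List Bool) {b D : ℕ} (h : D ≤ b) (i : ℕ) :
    ((threshold x b D i : ℕ) : ℝ) = threshold x (b : ℝ) D i := by
  unfold threshold
  split_ifs <;> cases x.getD i false <;> simp [prefixSum_cast, Nat.cast_sub h]

theorem prefixSum_homogeneous (x : List Bool) (b : ℝ) {D : ℝ} (hD : D ≠ 0) {i : ℕ}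
    (hi : i ≤ x.length) :
    prefixSum x b D i = D ^ (x.length - 1) * prefixSum x (b / D) 1 i := by
  rw [prefixSum, prefixSum, Finset.mul_sum]
  refine Finset.sum_congr rfl fun k hk => ?_
  have hk' := Finset.mem_range.1 hk
  have e : D ^ (x.length - 1) = D ^ (x.length - 1 - k) * D ^ k := by
    rw [← pow_add]
    congr 1
    omega
  rw [e, div_pow]
  field_simp
  simp

theorem threshold_homogeneous (x : List Bool) (b : ℝ) {D : ℝ} (hD : D ≠ 0) {i : ℕ}
    (hi : i ≤ x.length) :
    threshold x b D i = D ^ x.length * threshold x (b / D) 1 i := by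
  rcases Nat.eq_zero_or_pos x.length with h0 | h0
  · have : i = 0 := by omega
    subst this
    simp [threshold, prefixSum, h0]
  · have e1 : D ^ x.length = D * D ^ (x.length - 1) := by
      rw [← pow_succ', Nat.sub_add_cancel h0]
    rw [threshold, threshold, prefixSum_homogeneous x b hD hi, mul_add]
    congr 1
    · rw [e1]
      field_simp
    · split_ifs with h
      · have e2 : D ^ (x.length - 1) = D ^ (x.length - 1 - i) * D ^ i := by
          rw [← pow_add]
          congr 1
          omega
        rw [e1, e2, div_pow]
        cases x.getD i false <;> simp only [cond_true, cond_false] <;> field_simp <;> simp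
      · simp

theorem cutTest_iff {x : List Bool} {b D : ℕ} (hD : 0 < D) (h : D ≤ b) (e : ℕ) (a : ℕ × ℕ)
    {i : ℕ} (hi : i ≤ x.length) :
    cutTest x b D e a i = true ↔
      threshold x ((b : ℝ) / D) 1 i + (2 ^ e)⁻¹ ≤
        threshold x ((b : ℝ) / D) 1 (x.length - a.1) + a.2 * (2 ^ e)⁻¹ := by
  have hD' : (0 : ℝ) < D := by exact_mod_cast hD
  rw [cutTest, decide_eq_true_iff, ← Nat.cast_le (α := ℝ)]
  push_cast
  rw [threshold_cast x h, threshold_cast x h, threshold_homogeneous x _ hD'.ne' hi,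
    threshold_homogeneous x _ hD'.ne' (Nat.sub_le _ _)]
  have hp : (0 : ℝ) < 2 ^ e * D ^ x.length := by positivity
  have hc : (2 : ℝ) ^ e * (2 ^ e)⁻¹ = 1 := mul_inv_cancel₀ (by positivity)
  set v := threshold x ((b : ℝ) / D) 1 i
  set w := threshold x ((b : ℝ) / D) 1 (x.length - a.1)
  have e1 : 2 ^ e * (D : ℝ) ^ x.length * (v + (2 ^ e)⁻¹) =
      2 ^ e * ((D : ℝ) ^ x.length * v) + D ^ x.length := by
    linear_combination (D : ℝ) ^ x.length * hc
  have e2 : 2 ^ e * (D : ℝ) ^ x.length * (w + a.2 * (2 ^ e)⁻¹) =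
      2 ^ e * ((D : ℝ) ^ x.length * w) + a.2 * D ^ x.length := by
    linear_combination (D : ℝ) ^ x.length * a.2 * hc
  rw [← e1, ← e2, mul_le_mul_iff_right₀ hp]

end Thresholds

/-! ### Cuts of finite families of separated reals -/

section Cut

variable {M : ℕ} {u v : ℕ → ℝ} {e : ℝ} {L : ℕ → Prop}

/-- A nonempty initial segment `L` is cut off by its largest element j: with k = 2 the test is v i ≤
v j + e, which lies safely inside the gap of length 4 e. If `L` is empty, j minimises u and k = 0
makes the test fail everywhere. -/
theorem exists_cut_index (he : 0 < e) (huv : ∀ i ≤ M, |v i - u i| ≤ e / 8)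
    (hsep : ∀ i ≤ M, ∀ j ≤ M, u i < u j → u i + 4 * e ≤ u j)
    (hL : ∀ i ≤ M, ∀ j ≤ M, u i ≤ u j → L j → L i) :
    ∃ j ≤ M, ∃ k ≤ 2, ∀ i ≤ M, (L i ↔ v i + e ≤ v j + (k : ℕ) * e) := by
  classical
  have hv : ∀ i ≤ M, u i - e / 8 ≤ v i ∧ v i ≤ u i + e / 8 := fun i hi => by
    have := abs_le.1 (huv i hi)
    constructor <;> linarith
  by_cases hex : ∃ i ≤ M, L i
  · obtain ⟨i₀, hi₀, hLi₀⟩ := hex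
    obtain ⟨j, hj, hmax⟩ := ((Finset.range (M + 1)).filter L).exists_max_image u
      ⟨i₀, by simp [hLi₀]; omega⟩
    simp only [Finset.mem_filter, Finset.mem_range, Nat.lt_succ_iff] at hj hmax
    refine ⟨j, hj.1, 2, le_rfl, fun i hi => ?_⟩
    have h1 := hv i hi
    have h2 := hv j hj.1
    push_cast
    constructor
    · intro h
      have := hmax i ⟨hi, h⟩
      linarith
    · intro h
      by_contra hn
      have hlt : u j < u i := lt_of_not_ge fun h' => hn (hL i hi j hj.1 h' hj.2)
      have := hsep j hj.1 i hi hlt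
      linarith
  · push Not at hex
    obtain ⟨j, hj, hmin⟩ := (Finset.range (M + 1)).exists_min_image u ⟨0, by simp⟩
    simp only [Finset.mem_range, Nat.lt_succ_iff] at hj hmin
    refine ⟨j, hj, 0, by omega, fun i hi => ⟨fun h => absurd h (hex i hi), fun h => ?_⟩⟩
    have h1 := hv i hi
    have h2 := hv j hj
    have := hmin i hi
    push_cast at h
    linarith

/-- Here the cut is located from the single reference point v M by a multiple of e. Gaps of length 4
e leave room for rounding the largest element of `L` to this grid; if `L` has no element at or above
u M, then it is {u i < u M} and k = 0 works. -/
theorem exists_cut_offset (he : 0 < e) (huv : ∀ i ≤ M, |v i - u i| ≤ e / 8)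
    (hsep : ∀ i ≤ M, ∀ j ≤ M, u i < u j → u i + 4 * e ≤ u j)
    (hL : ∀ i ≤ M, ∀ j ≤ M, u i ≤ u j → L j → L i)
    (hlow : ∀ i ≤ M, u i < u M → L i) (hup : ∀ i ≤ M, L i → u i ≤ u M + 1) :
    ∃ k ≤ ⌈(1 + e) / e⌉₊ + 2, ∀ i ≤ M, (L i ↔ v i + e ≤ v M + (k : ℕ) * e) := by
  classical
  have hv : ∀ i ≤ M, u i - e / 8 ≤ v i ∧ v i ≤ u i + e / 8 := fun i hi => by
    have := abs_le.1 (huv i hi)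
    constructor <;> linarith
  have hM := hv M le_rfl
  by_cases hex : ∃ i ≤ M, L i ∧ u M ≤ u i
  · obtain ⟨i₀, hi₀, hLi₀, hui₀⟩ := hex
    obtain ⟨j, hj, hmax⟩ := ((Finset.range (M + 1)).filter L).exists_max_image u
      ⟨i₀, by simp [hLi₀]; omega⟩
    simp only [Finset.mem_filter, Finset.mem_range, Nat.lt_succ_iff] at hj hmax
    have huj := hmax i₀ ⟨hi₀, hLi₀⟩
    have h2 := hv j hj.1
    have hupj := hup j hj.1 hj.2
    set d := (v j - v M) / e with hd
    have hde : d * e = v j - v M := div_mul_cancel₀ _ he.ne'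
    have hd1 : -1 < d := by
      rw [hd, lt_div_iff₀ he]
      linarith
    have hc1 : d ≤ ⌈d⌉₊ := Nat.le_ceil d
    -- Approximation errors can make d slightly negative; the natural ceiling is then 0, which is
    -- still below d + 1.
    have hc2 : (⌈d⌉₊ : ℝ) < d + 1 := by
      rcases le_or_gt 0 d with h | h
      · exact Nat.ceil_lt_add_one h
      · rw [Nat.ceil_eq_zero.2 h.le]
        push_cast
        linarith
    have hc1e := mul_le_mul_of_nonneg_right hc1 he.le
    have hc2e := mul_lt_mul_of_pos_right hc2 he
    refine ⟨⌈d⌉₊ + 2, ?_, fun i hi => ?_⟩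
    · refine Nat.add_le_add_right (Nat.ceil_mono (div_le_div_of_nonneg_right ?_ he.le)) 2
      linarith
    have h1 := hv i hi
    push_cast
    constructor
    · intro h
      have := hmax i ⟨hi, h⟩
      linarith
    · intro h
      by_contra hn
      have hlt : u j < u i := lt_of_not_ge fun h' => hn (hL i hi j hj.1 h' hj.2)
      have := hsep j hj.1 i hi hlt
      linarith
  · push Not at hex
    refine ⟨0, by omega, fun i hi => ?_⟩
    have h1 := hv i hi
    push_cast
    constructor
    · intro h
      have := hsep i hi M le_rfl (hex i hi h)
      linarith
    · intro h
      refine hlow i hi (lt_of_not_ge fun h' => ?_)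
      linarith

end Cut

/-! ### Separation of thresholds -/

/-- Distinct thresholds of a word of length `m` differ by at least `4 · 2 ^ (-(c₁ m + c₀))`. -/
def ThresholdsSeparated (β : ℝ) (c₁ c₀ : ℕ) : Prop :=
  ∀ x : List Bool, ∀ i ≤ x.length, ∀ j ≤ x.length, threshold x β 1 i < threshold x β 1 j →
    threshold x β 1 i + 4 * (2 ^ (c₁ * x.length + c₀))⁻¹ ≤ threshold x β 1 j

theorem thresholdsSeparated_of_le {β c B : ℝ} (hc : 0 < c) (hB : 1 ≤ B)
    (h : ∀ Q : Polynomial ℤ, (∀ k, |(Q.coeff k : ℝ)| ≤ 6) → Polynomial.aeval β Q ≠ 0 →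
      c ≤ B ^ Q.natDegree * |Polynomial.aeval β Q|) {c₁ : ℕ} (hc₁ : B ≤ 2 ^ c₁) :
    ∃ c₀, ThresholdsSeparated β c₁ c₀ := by
  -- The 4 is the factor in the definition of separation.
  obtain ⟨c₀, hc₀⟩ := pow_unbounded_of_one_lt (4 / c) (by norm_num : (1 : ℝ) < 2)
  rw [div_lt_iff₀ hc] at hc₀
  refine ⟨c₀, fun x i hi j hj hlt => ?_⟩
  have hQ : Polynomial.aeval β (thresholdPoly x j - thresholdPoly x i) =
      threshold x β 1 j - threshold x β 1 i := by
    rw [map_sub, aeval_thresholdPoly, aeval_thresholdPoly]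
  have hpos : 0 < threshold x β 1 j - threshold x β 1 i := sub_pos.2 hlt
  have hmain := h (thresholdPoly x j - thresholdPoly x i) (fun k => ?_) (by rw [hQ]; exact hpos.ne')
  · rw [hQ, abs_of_pos hpos] at hmain
    have hdeg : (thresholdPoly x j - thresholdPoly x i).natDegree ≤ x.length :=
      (Polynomial.natDegree_sub_le _ _).trans
        (max_le (natDegree_thresholdPoly_le j) (natDegree_thresholdPoly_le i))
    have hB2 : B ^ (thresholdPoly x j - thresholdPoly x i).natDegree ≤ 2 ^ (c₁ * x.length) := by
      rw [pow_mul]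
      exact (pow_le_pow_right₀ hB hdeg).trans (pow_le_pow_left₀ (by linarith) hc₁ _)
    have h1 := hmain.trans (mul_le_mul_of_nonneg_right hB2 hpos.le)
    have h2 : 4 * (2 ^ (c₁ * x.length + c₀))⁻¹ ≤ threshold x β 1 j - threshold x β 1 i := by
      rw [← div_eq_mul_inv, div_le_iff₀ (by positivity), pow_add]
      have h3 := mul_le_mul_of_nonneg_left h1 (by positivity : (0 : ℝ) ≤ 2 ^ c₀)
      linarith
    linarith
  · rw [Polynomial.coeff_sub]
    have ha := abs_le.1 (abs_coeff_thresholdPoly_le hi k)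
    have hb := abs_le.1 (abs_coeff_thresholdPoly_le hj k)
    have : |(thresholdPoly x j).coeff k - (thresholdPoly x i).coeff k| ≤ 6 := by
      rw [abs_le]
      constructor <;> linarith [ha.1, ha.2, hb.1, hb.2]
    exact_mod_cast this

theorem exists_thresholdsSeparated {β : ℝ} (hβ : IsAlgebraic ℤ β) :
    ∃ c₁ c₀, ThresholdsSeparated β c₁ c₀ := by
  obtain ⟨c, hc, B, hB, h⟩ := exists_le_pow_mul_abs_aeval hβ (H := 6) (by norm_num)
  obtain ⟨c₁, hc₁⟩ := pow_unbounded_of_one_lt B (by norm_num : (1 : ℝ) < 2)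
  exact ⟨c₁, thresholdsSeparated_of_le hc hB h hc₁.le⟩

theorem IsPisot.exists_thresholdsSeparated {β : ℝ} (hβ : IsPisot β) :
    ∃ c₀, ThresholdsSeparated β 0 c₀ := by
  obtain ⟨c, hc, h⟩ := hβ.exists_le_abs_aeval (H := 6) (by norm_num)
  exact thresholdsSeparated_of_le hc le_rfl (by simpa using h) (by simp)

/-! ### Correctness of the decoding algorithm -/

/-- The rational approximation of `β` used by `decode`. -/
noncomputable def approx (β : ℝ) (c₁ c₀ m : ℕ) : ℝ :=
  (⌊β * 2 ^ digits c₁ c₀ m⌋₊ : ℝ) / ((2 ^ digits c₁ c₀ m : ℕ) : ℝ)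

theorem two_pow_digits_le_floor {β : ℝ} (hβ : β ∈ Set.Ioo (1 : ℝ) 2) (c₁ c₀ m : ℕ) :
    2 ^ digits c₁ c₀ m ≤ ⌊β * 2 ^ digits c₁ c₀ m⌋₊ := by
  refine Nat.le_floor ?_
  push_cast
  exact le_mul_of_one_le_left (by positivity) hβ.1.le

theorem one_le_approx {β : ℝ} (hβ : β ∈ Set.Ioo (1 : ℝ) 2) (c₁ c₀ m : ℕ) :
    1 ≤ approx β c₁ c₀ m := by
  rw [approx, one_le_div (by positivity)]
  exact_mod_cast two_pow_digits_le_floor hβ c₁ c₀ m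

theorem approx_le {β : ℝ} (hβ : β ∈ Set.Ioo (1 : ℝ) 2) (c₁ c₀ m : ℕ) :
    approx β c₁ c₀ m ≤ β := by
  rw [approx, div_le_iff₀ (by positivity)]
  push_cast
  exact Nat.floor_le (mul_nonneg (by linarith [hβ.1]) (by positivity))

/-- Of the extra 2 m + 10 digits, 2 m cancel the Lipschitz factor 4^m and 10 leave a margin of 1024
for the constants. -/
theorem four_pow_mul_sub_approx_le (β : ℝ) (c₁ c₀ m : ℕ) :
    4 ^ m * (β - approx β c₁ c₀ m) ≤ (2 ^ (c₁ * m + c₀))⁻¹ / 1024 := by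
  have h : β - approx β c₁ c₀ m ≤ (2 ^ digits c₁ c₀ m)⁻¹ := by
    have hf := (Nat.lt_floor_add_one (β * 2 ^ digits c₁ c₀ m)).le
    have hp : (0 : ℝ) < 2 ^ digits c₁ c₀ m := by positivity
    rw [approx, sub_le_iff_le_add]
    push_cast
    rw [← one_div, ← add_div, le_div_iff₀ hp]
    linarith
  refine (mul_le_mul_of_nonneg_left h (by positivity)).trans (le_of_eq ?_)
  have e : (2 : ℝ) ^ digits c₁ c₀ m = 2 ^ (c₁ * m + c₀) * 4 ^ m * 1024 := by
    rw [digits, pow_add, pow_add _ _ (2 * m), pow_mul 2 2 m]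
    norm_num
  rw [e]
  field_simp

theorem four_pow_mul_sub_approx_le' (β : ℝ) (c₁ c₀ m : ℕ) :
    4 ^ m * (β - approx β c₁ c₀ m) ≤ 1 / 1024 := by
  refine (four_pow_mul_sub_approx_le β c₁ c₀ m).trans ?_
  have : ((2 : ℝ) ^ (c₁ * m + c₀))⁻¹ ≤ 1 := inv_le_one_of_one_le₀ (one_le_pow₀ (by norm_num))
  linarith

theorem pow_le_two_mul_approx_pow {β : ℝ} (hβ : β ∈ Set.Ioo (1 : ℝ) 2) (c₁ c₀ m : ℕ) :
    β ^ m ≤ 2 * approx β c₁ c₀ m ^ m := by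
  have h1 := one_le_approx hβ c₁ c₀ m
  have h2 := pow_sub_pow_le (by linarith) (approx_le hβ c₁ c₀ m) hβ.2.le m
  have h3 := four_pow_mul_sub_approx_le' β c₁ c₀ m
  have h4 : 1 ≤ approx β c₁ c₀ m ^ m := one_le_pow₀ h1
  linarith

theorem abs_threshold_approx_sub_le {β : ℝ} (hβ : β ∈ Set.Ioo (1 : ℝ) 2) (c₁ c₀ : ℕ)
    {x : List Bool} {i : ℕ} (hi : i ≤ x.length) :
    |threshold x (approx β c₁ c₀ x.length) 1 i - threshold x β 1 i| ≤
      (2 ^ (c₁ * x.length + c₀))⁻¹ / 8 := by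
  have h1 := one_le_approx hβ c₁ c₀ x.length
  have h := abs_aeval_sub_aeval_le (Q := thresholdPoly x i) (H := 3)
    (fun k => by exact_mod_cast abs_coeff_thresholdPoly_le hi k) (natDegree_thresholdPoly_le i)
    (by linarith) (approx_le hβ c₁ c₀ x.length) hβ.2.le
  rw [aeval_thresholdPoly, aeval_thresholdPoly, pow_succ] at h
  have h3 := four_pow_mul_sub_approx_le β c₁ c₀ x.length
  have h4 : (0 : ℝ) < (2 ^ (c₁ * x.length + c₀))⁻¹ := by positivity
  linarith

theorem abs_prefixSum_approx_sub_le {β : ℝ} (hβ : β ∈ Set.Ioo (1 : ℝ) 2) (c₁ c₀ : ℕ)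
    (x : List Bool) :
    |prefixSum x (approx β c₁ c₀ x.length) 1 x.length - prefixSum x β 1 x.length| ≤ 1 := by
  have h1 := one_le_approx hβ c₁ c₀ x.length
  have e : ∀ y : ℝ, Polynomial.aeval y (prefixSum x (Polynomial.X : Polynomial ℤ) 1 x.length) =
      prefixSum x y 1 x.length := fun y => by
    simpa using map_prefixSum (Polynomial.aeval (R := ℤ) y).toRingHom x Polynomial.X 1 x.length
  have h := abs_aeval_sub_aeval_le (Q := prefixSum x Polynomial.X 1 x.length) (H := 1)
    (fun k => by
      have := coeff_prefixSum (x := x) le_rfl k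
      rw [abs_of_nonneg (by exact_mod_cast this.1)]
      exact_mod_cast this.2)
    ((natDegree_prefixSum_le x _).trans (Nat.sub_le _ 1))
    (by linarith) (approx_le hβ c₁ c₀ x.length) hβ.2.le
  rw [e, e, pow_succ] at h
  have h3 := four_pow_mul_sub_approx_le' β c₁ c₀ x.length
  linarith

theorem two_pow_mul_pow_le_iff (β : ℝ) (c₁ c₀ m k : ℕ) :
    2 ^ k * (2 ^ digits c₁ c₀ m) ^ m ≤ ⌊β * 2 ^ digits c₁ c₀ m⌋₊ ^ m ↔
      (2 : ℝ) ^ k ≤ approx β c₁ c₀ m ^ m := by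
  rw [approx, div_pow, le_div_iff₀ (by positivity)]
  exact_mod_cast Iff.rfl

theorem scaledLength_spec {β : ℝ} (hβ : β ∈ Set.Ioo (1 : ℝ) 2) (n : ℕ) :
    (2 : ℝ) ^ n ≤ β ^ scaledLength β n ∧ β ^ scaledLength β n < 2 ^ (n + 1) ∧
      n ≤ scaledLength β n := by
  have h0 : (0 : ℝ) < β := by linarith [hβ.1]
  have hlog : 0 ≤ (n : ℝ) * Real.logb β 2 :=
    mul_nonneg (by positivity) (Real.logb_nonneg hβ.1 (by norm_num))
  have e : β ^ ((n : ℝ) * Real.logb β 2) = 2 ^ n := by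
    rw [mul_comm, Real.rpow_mul h0.le, Real.rpow_logb h0 hβ.1.ne' (by norm_num),
      Real.rpow_natCast]
  have h1 : (2 : ℝ) ^ n ≤ β ^ scaledLength β n := by
    rw [← e, ← Real.rpow_natCast]
    exact Real.rpow_le_rpow_of_exponent_le hβ.1.le (Nat.le_ceil _)
  refine ⟨h1, ?_, ?_⟩
  · have h2 : β ^ scaledLength β n < β ^ ((n : ℝ) * Real.logb β 2 + 1) := by
      rw [← Real.rpow_natCast]
      exact Real.rpow_lt_rpow_of_exponent_lt hβ.1 (Nat.ceil_lt_add_one hlog)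
    rw [Real.rpow_add h0, Real.rpow_one, e] at h2
    rw [pow_succ]
    exact h2.trans (mul_lt_mul_of_pos_left hβ.2 (by positivity))
  · have h3 := h1.trans (pow_le_pow_left₀ h0.le hβ.2.le _)
    exact (pow_le_pow_iff_right₀ (by norm_num : (1 : ℝ) < 2)).1 h3

/-- The decoder sees m but not n. As 2^n ≤ β^m < 2^{n+1} and the approximate power is between β^m /
2 and β^m, it finds n up to one unit, which the advice supplies. -/
theorem binaryLength_bounds {β : ℝ} (hβ : β ∈ Set.Ioo (1 : ℝ) 2) (c₁ c₀ : ℕ) {n : ℕ}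
    (hn : 1 ≤ n) {m : ℕ} (hm : m = scaledLength β n) :
    binaryLength m ⌊β * 2 ^ digits c₁ c₀ m⌋₊ (2 ^ digits c₁ c₀ m) ≤ n ∧
      n ≤ binaryLength m ⌊β * 2 ^ digits c₁ c₀ m⌋₊ (2 ^ digits c₁ c₀ m) + 1 := by
  obtain ⟨h1, h2, h3⟩ := scaledLength_spec hβ n
  rw [← hm] at h1 h2 h3
  have ha1 := one_le_approx hβ c₁ c₀ m
  have hpow := pow_le_two_mul_approx_pow hβ c₁ c₀ m
  constructor
  · have hspec := Nat.findGreatest_spec (m := 0) (n := m)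
      (P := fun k => 2 ^ k * (2 ^ digits c₁ c₀ m) ^ m ≤ ⌊β * 2 ^ digits c₁ c₀ m⌋₊ ^ m)
      (Nat.zero_le _) ((two_pow_mul_pow_le_iff β c₁ c₀ m 0).2 (by simpa using one_le_pow₀ ha1))
    have h4 := (two_pow_mul_pow_le_iff β c₁ c₀ m _).1 hspec
    have h5 := pow_le_pow_left₀ (by linarith) (approx_le hβ c₁ c₀ m) m
    have h6 := (h4.trans h5).trans_lt h2
    exact Nat.lt_succ_iff.1 ((pow_lt_pow_iff_right₀ (by norm_num : (1 : ℝ) < 2)).1 h6)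
  · have h4 : n - 1 ≤ binaryLength m ⌊β * 2 ^ digits c₁ c₀ m⌋₊ (2 ^ digits c₁ c₀ m) := by
      refine Nat.le_findGreatest (by omega) ((two_pow_mul_pow_le_iff β c₁ c₀ m _).2 ?_)
      have h5 : (2 : ℝ) ^ n = 2 ^ (n - 1) * 2 := by rw [← pow_succ, Nat.sub_add_cancel hn]
      linarith
    omega

/-- The binary expansion computed from a prefix of a `β`-expansion is correct up to a bounded
error. -/
theorem binaryApprox_bounds {β : ℝ} (hβ : β ∈ Set.Ioo (1 : ℝ) 2) (c₁ c₀ : ℕ) {n : ℕ}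
    (hn : 1 ≤ n) {m : ℕ} (hm : m = scaledLength β n) {s : ℝ} (hs : s ≤ 1) {x : ℕ → Bool}
    (hx : x ∈ expansions β s) {Z : ℕ}
    (hZ : Z = 2 ^ n * 2 ^ digits c₁ c₀ m * prefixSum (take x m) ⌊β * 2 ^ digits c₁ c₀ m⌋₊
      (2 ^ digits c₁ c₀ m) m / ⌊β * 2 ^ digits c₁ c₀ m⌋₊ ^ m) :
    (Z : ℝ) ≤ 2 ^ n * s + 2 ∧ 2 ^ n * s ≤ Z + 2 + (β - 1)⁻¹ := by
  obtain ⟨h1, h2, h3⟩ := scaledLength_spec hβ n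
  rw [← hm] at h1 h2 h3
  have ha1 := one_le_approx hβ c₁ c₀ m
  have hale := approx_le hβ c₁ c₀ m
  have hpow := pow_le_two_mul_approx_pow hβ c₁ c₀ m
  have hdiff := pow_sub_pow_le (by linarith) hale hβ.2.le m
  have hdiff' := four_pow_mul_sub_approx_le' β c₁ c₀ m
  have hps := abs_le.1 (abs_prefixSum_approx_sub_le hβ c₁ c₀ (take x m))
  have hr := pow_mul_remainder β s x (le_refl m)
  have hmem := tail_mem_expansions hβ hx m
  have hr0 := nonneg_of_mem_expansions hβ.1 hmem
  have hr1 := le_of_mem_expansions hβ.1 hmem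
  rw [length_take] at hps
  rw [Nat.sub_self, pow_zero, one_mul] at hr
  set R := (β - 1)⁻¹
  set D : ℕ := 2 ^ digits c₁ c₀ m with hD
  set b := ⌊β * 2 ^ digits c₁ c₀ m⌋₊ with hb
  have hD0 : (0 : ℝ) < D := by rw [hD]; positivity
  have hDb : D ≤ b := two_pow_digits_le_floor hβ c₁ c₀ m
  have hb0 : (0 : ℝ) < b := hD0.trans_le (by exact_mod_cast hDb)
  have hat : approx β c₁ c₀ m = b / D := rfl
  set t := approx β c₁ c₀ m
  set g := prefixSum (take x m) β 1 m
  set G := prefixSum (take x m) t 1 m with hG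
  have ht0 : 0 < t := by linarith
  have htm : 0 < t ^ m := by positivity
  have hβ0 : (0 : ℝ) < β := by linarith
  have hβm : 0 < β ^ m := by positivity
  have hG0 : 0 ≤ G := Finset.sum_nonneg fun k _ => by positivity
  have hreal : ((2 ^ n * D * prefixSum (take x m) b D m : ℕ) : ℝ) / ((b ^ m : ℕ) : ℝ) =
      2 ^ n * G / t ^ m := by
    push_cast
    rw [prefixSum_cast, prefixSum_homogeneous _ _ hD0.ne' (length_take x m).ge, length_take,
      ← hat, ← hG, hat, div_pow]
    have e : (D : ℝ) ^ m = D * D ^ (m - 1) := by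
      rw [← pow_succ', Nat.sub_add_cancel (by omega)]
    rw [e]
    field_simp
  have hZ1 : (Z : ℝ) ≤ 2 ^ n * G / t ^ m := by
    rw [← hreal, hZ]
    exact Nat.cast_div_le
  have hZ2 : 2 ^ n * G / t ^ m ≤ Z + 1 := by
    rw [← hreal, hZ]
    rw [← Nat.floor_div_eq_div (K := ℝ)]
    exact (Nat.lt_floor_add_one _).le
  have hg : g ≤ β ^ m := by
    have := mul_le_mul_of_nonneg_left hs hβm.le
    linarith
  have h1m : 1 ≤ β ^ m := one_le_pow₀ hβ.1.le
  have hGt : G / t ^ m ≤ 4 := by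
    rw [div_le_iff₀ htm]
    linarith
  have hGt0 : 0 ≤ G / t ^ m := by positivity
  -- Error budget: 1 for the floor, 1 for t^m in place of β^m, 1 for G in place of g (as q ≤ 1), and
  -- R for the remainder after m steps. Their signs leave 2 on one side and 2 + R on the other.
  set q := 2 ^ n / β ^ m with hq
  have hq0 : 0 ≤ q := by positivity
  have hq1 : q ≤ 1 := (div_le_one hβm).2 h1
  have hqβ : q * β ^ m = 2 ^ n := div_mul_cancel₀ _ hβm.ne'
  have hA : 2 ^ n * G / t ^ m - q * G = q * (G / t ^ m * (β ^ m - t ^ m)) := by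
    rw [← hqβ]
    field_simp
  have hd0 : 0 ≤ β ^ m - t ^ m := sub_nonneg.2 (pow_le_pow_left₀ ht0.le hale m)
  have hA0 : 0 ≤ q * (G / t ^ m * (β ^ m - t ^ m)) := by positivity
  have hA1 : q * (G / t ^ m * (β ^ m - t ^ m)) ≤ 1 := by
    have h4 : G / t ^ m * (β ^ m - t ^ m) ≤ 4 * (1 / 1024) :=
      mul_le_mul hGt (hdiff.trans hdiff') hd0 (by norm_num)
    have h5 := mul_le_mul hq1 h4 (mul_nonneg hGt0 hd0) zero_le_one
    linarith
  have hB1 : q * G ≤ q * g + 1 := by nlinarith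
  have hB2 : q * g ≤ q * G + 1 := by nlinarith
  have hC : q * g = 2 ^ n * s - q * remainder β s x m := by
    rw [← hqβ, hr]
    ring
  have hC0 : 0 ≤ q * remainder β s x m := mul_nonneg hq0 hr0
  have hC1 : q * remainder β s x m ≤ R :=
    (mul_le_of_le_one_left hr0 hq1).trans hr1
  constructor <;> linarith

theorem exists_decode_eq {β : ℝ} (hβ : β ∈ Set.Ioo (1 : ℝ) 2) {c₁ c₀ n : ℕ} (hn : 1 ≤ n)
    {m : ℕ} (hm : m = scaledLength β n) {s : ℝ} (hs : s ∈ Set.Icc (0 : ℝ) 1) {x : ℕ → Bool}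
    (hx : x ∈ expansions β s) {a₁ a₂ : ℕ × ℕ}
    (h₁ : ∀ i ≤ m, cutTest (take x m) ⌊β * 2 ^ digits c₁ c₀ m⌋₊ (2 ^ digits c₁ c₀ m)
      (c₁ * m + c₀) a₁ i = true ↔ threshold (take x m) β 1 i ≤ (β - 1) * β ^ m * s)
    (h₂ : ∀ i ≤ m, cutTest (take x m) ⌊β * 2 ^ digits c₁ c₀ m⌋₊ (2 ^ digits c₁ c₀ m)
      (c₁ * m + c₀) a₂ i = true ↔ threshold (take x m) β 1 i < (β - 1) * β ^ m * s) :
    ∃ a₃ : ℕ × ℕ, a₃.1 ≤ 1 ∧ a₃.2 ≤ 8 + ⌈(β - 1)⁻¹⌉₊ ∧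
      decode β c₁ c₀ (take x m) (Encodable.encode (a₁, a₂, a₃)) =
        pair (take (greedyBinary s) n) (coinTossWord β s (take x m)) := by
  obtain ⟨hl1, hl2⟩ := binaryLength_bounds hβ c₁ c₀ hn hm
  obtain ⟨Y, -, hY, htake⟩ := exists_take_greedyBinary n hs
  set Z := 2 ^ n * 2 ^ digits c₁ c₀ m * prefixSum (take x m) ⌊β * 2 ^ digits c₁ c₀ m⌋₊
      (2 ^ digits c₁ c₀ m) m / ⌊β * 2 ^ digits c₁ c₀ m⌋₊ ^ m with hZ
  obtain ⟨hZ1, hZ2⟩ := binaryApprox_bounds hβ c₁ c₀ hn hm hs.2 hx hZ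
  rw [abs_le] at hY
  have hZY : Z ≤ Y + 3 := by
    have : (Z : ℝ) ≤ Y + 3 := by linarith
    exact_mod_cast this
  have hYZ : Y ≤ Z + 3 + ⌈(β - 1)⁻¹⌉₊ := by
    have := Nat.le_ceil (β - 1)⁻¹
    have : (Y : ℝ) ≤ Z + 3 + ⌈(β - 1)⁻¹⌉₊ := by linarith
    exact_mod_cast this
  -- Z ≤ Y + 3, so neither this subtraction nor the one in `decodeWith` truncates.
  refine ⟨(n - binaryLength m ⌊β * 2 ^ digits c₁ c₀ m⌋₊ (2 ^ digits c₁ c₀ m), Y + 4 - Z),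
    by dsimp only; omega, by dsimp only; omega, ?_⟩
  simp only [decode, Denumerable.ofNat_encode, decodeWith, length_take]
  rw [Nat.add_sub_cancel' hl1, ← hZ, show Z + (Y + 4 - Z) - 4 = Y by omega, htake]
  congr 1
  symm
  refine coinTossWord_eq_selectWord hβ hx fun i hi => ?_
  rw [mem_switchRegion_iff hβ hx hi]
  cases hxi : x i
  · simpa using h₁ i hi.le
  · rw [cond_true, if_pos rfl, Bool.not_eq_true', ← Bool.not_eq_true, h₂ i hi.le]

/-! ### Existence and size of the advice -/

section Advice

variable {β : ℝ} {c₁ c₀ : ℕ} {x : List Bool} {L : ℕ → Prop}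

theorem exists_cutTest_iff (hβ : β ∈ Set.Ioo (1 : ℝ) 2) (hsep : ThresholdsSeparated β c₁ c₀)
    (hL : ∀ i ≤ x.length, ∀ j ≤ x.length,
      threshold x β 1 i ≤ threshold x β 1 j → L j → L i) :
    ∃ a : ℕ × ℕ, a.1 ≤ x.length ∧ a.2 ≤ 2 ∧ ∀ i ≤ x.length,
      (cutTest x ⌊β * 2 ^ digits c₁ c₀ x.length⌋₊ (2 ^ digits c₁ c₀ x.length)
        (c₁ * x.length + c₀) a i = true ↔ L i) := by
  obtain ⟨j, hj, k, hk, h⟩ := exists_cut_index (v := threshold x (approx β c₁ c₀ x.length) 1)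
    (by positivity) (fun i hi => abs_threshold_approx_sub_le hβ c₁ c₀ hi) (hsep x) hL
  -- Indices are counted from the end of the word, so that the last threshold always has the code 0.
  refine ⟨(x.length - j, k), Nat.sub_le _ _, hk, fun i hi => ?_⟩
  rw [cutTest_iff (by positivity) (two_pow_digits_le_floor hβ c₁ c₀ x.length) _ _ hi, h i hi]
  dsimp only
  rw [Nat.sub_sub_self hj]
  rfl

theorem exists_cutTest_zero_iff (hβ : β ∈ Set.Ioo (1 : ℝ) 2) (hsep : ThresholdsSeparated β 0 c₀)
    (hL : ∀ i ≤ x.length, ∀ j ≤ x.length,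
      threshold x β 1 i ≤ threshold x β 1 j → L j → L i)
    (hlow : ∀ i ≤ x.length, threshold x β 1 i < threshold x β 1 x.length → L i)
    (hup : ∀ i ≤ x.length, L i → threshold x β 1 i ≤ threshold x β 1 x.length + 1) :
    ∃ k ≤ ⌈(1 + ((2 : ℝ) ^ c₀)⁻¹) / (2 ^ c₀)⁻¹⌉₊ + 2, ∀ i ≤ x.length,
      (cutTest x ⌊β * 2 ^ digits 0 c₀ x.length⌋₊ (2 ^ digits 0 c₀ x.length)
        (0 * x.length + c₀) (0, k) i = true ↔ L i) := by
  have e : 0 * x.length + c₀ = c₀ := by omega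
  obtain ⟨k, hk, h⟩ := exists_cut_offset (v := threshold x (approx β 0 c₀ x.length) 1)
    (by positivity) (fun i hi => abs_threshold_approx_sub_le hβ 0 c₀ hi) (hsep x) hL hlow hup
  refine ⟨k, by rwa [e] at hk, fun i hi => ?_⟩
  rw [cutTest_iff (by positivity) (two_pow_digits_le_floor hβ 0 c₀ x.length) _ _ hi, h i hi]
  rfl

theorem pair_lt_sq {a b T : ℕ} (ha : a < T) (hb : b < T) : Nat.pair a b < T ^ 2 :=
  (Nat.pair_lt_max_add_one_sq a b).trans_le (Nat.pow_le_pow_left (max_lt ha hb) 2)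

/-- Each level of pairing at most squares the bound, and there are three levels. -/
theorem encode_advice_lt {a : (ℕ × ℕ) × (ℕ × ℕ) × (ℕ × ℕ)} {T : ℕ}
    (h₁ : a.1.1 < T ∧ a.1.2 < T) (h₂ : a.2.1.1 < T ∧ a.2.1.2 < T)
    (h₃ : a.2.2.1 < T ∧ a.2.2.2 < T) : Encodable.encode a < T ^ 8 := by
  have hT : T ^ 2 ≤ (T ^ 2) ^ 2 := Nat.le_self_pow (by norm_num) _
  have h := pair_lt_sq ((pair_lt_sq h₁.1 h₁.2).trans_le hT)
    (pair_lt_sq (pair_lt_sq h₂.1 h₂.2) (pair_lt_sq h₃.1 h₃.2))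
  rw [← pow_mul, ← pow_mul] at h
  exact h

theorem two_pow_size_le (a : ℕ) : 2 ^ a.size ≤ 2 * a + 1 := by
  rcases h : a.size with _ | k
  · simp
  · have := Nat.lt_size.1 (show k < a.size by omega)
    rw [pow_succ]
    omega

theorem exists_advice (hβ : β ∈ Set.Ioo (1 : ℝ) 2) (hsep : ThresholdsSeparated β c₁ c₀)
    {n : ℕ} (hn : 1 ≤ n) {s : ℝ} (hs : s ∈ Set.Icc (0 : ℝ) 1) {x : ℕ → Bool}
    (hx : x ∈ expansions β s) :
    ∃ a < (scaledLength β n + (9 + ⌈(β - 1)⁻¹⌉₊)) ^ 8,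
      decode β c₁ c₀ (take x (scaledLength β n)) a = pair (take (greedyBinary s) n)
        (coinTossWord β s (take x (scaledLength β n))) := by
  obtain ⟨m, hm⟩ : ∃ m, m = scaledLength β n := ⟨_, rfl⟩
  rw [← hm]
  obtain ⟨a₁, h11, h12, h₁⟩ := exists_cutTest_iff (x := take x m)
    (L := fun i => threshold (take x m) β 1 i ≤ (β - 1) * β ^ m * s) hβ hsep
    fun i _ j _ h h' => h.trans h'
  obtain ⟨a₂, h21, h22, h₂⟩ := exists_cutTest_iff (x := take x m)
    (L := fun i => threshold (take x m) β 1 i < (β - 1) * β ^ m * s) hβ hsep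
    fun i _ j _ h h' => h.trans_lt h'
  rw [length_take] at h11 h₁ h21 h₂
  obtain ⟨a₃, h31, h32, h⟩ := exists_decode_eq hβ hn hm hs hx h₁ h₂
  exact ⟨_, encode_advice_lt (by dsimp only; omega) (by dsimp only; omega)
    (by dsimp only; omega), h⟩

/-- With a step independent of the word length, the cuts lie boundedly many steps above the last
threshold, so `T` is uniform in n. -/
theorem exists_advice_of_zero (hβ : β ∈ Set.Ioo (1 : ℝ) 2) (hsep : ThresholdsSeparated β 0 c₀) :
    ∃ T : ℕ, ∀ n : ℕ, 1 ≤ n → ∀ s ∈ Set.Icc (0 : ℝ) 1, ∀ x ∈ expansions β s, ∃ a < T,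
      decode β 0 c₀ (take x (scaledLength β n)) a = pair (take (greedyBinary s) n)
        (coinTossWord β s (take x (scaledLength β n))) := by
  refine ⟨(⌈(1 + ((2 : ℝ) ^ c₀)⁻¹) / (2 ^ c₀)⁻¹⌉₊ + 3 + (9 + ⌈(β - 1)⁻¹⌉₊)) ^ 8, ?_⟩
  intro n hn s hs x hx
  obtain ⟨m, hm⟩ : ∃ m, m = scaledLength β n := ⟨_, rfl⟩
  rw [← hm]
  obtain ⟨hu1, hu2⟩ := threshold_length_le hβ hx m
  obtain ⟨k₁, hk₁, h₁⟩ := exists_cutTest_zero_iff (x := take x m)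
    (L := fun i => threshold (take x m) β 1 i ≤ (β - 1) * β ^ m * s) hβ hsep
    (fun i _ j _ h h' => h.trans h')
    (fun i _ h => by rw [length_take] at h; exact h.le.trans hu1)
    (fun i _ h => by rw [length_take]; exact h.trans hu2)
  obtain ⟨k₂, hk₂, h₂⟩ := exists_cutTest_zero_iff (x := take x m)
    (L := fun i => threshold (take x m) β 1 i < (β - 1) * β ^ m * s) hβ hsep
    (fun i _ j _ h h' => h.trans_lt h')
    (fun i _ h => by rw [length_take] at h; exact h.trans_le hu1)
    (fun i _ h => by rw [length_take]; exact h.le.trans hu2)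
  rw [length_take] at h₁ h₂
  obtain ⟨a₃, h31, h32, h⟩ := exists_decode_eq hβ hn hm hs hx h₁ h₂
  exact ⟨_, encode_advice_lt (by dsimp only; omega) (by dsimp only; omega)
    (by dsimp only; omega), h⟩

end Advice

/-- `scaledLength` is linear in n, so the advice is polynomial in n; additive constants are absorbed
since log (n + 1) ≥ log 2. -/
theorem exists_size_le_mul_log {β : ℝ} (hβ : 1 < β) (c d : ℕ) :
    ∃ C : ℝ, ∀ n : ℕ, 1 ≤ n → ∀ a < (scaledLength β n + c) ^ d,
      (a.size : ℝ) ≤ C * Real.log ((n : ℝ) + 1) := by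
  have hlb : 0 ≤ Real.logb β 2 := Real.logb_nonneg hβ (by norm_num)
  have hl2 : 0 < Real.log 2 := Real.log_pos (by norm_num)
  set K : ℝ := Real.logb β 2 + 1 + c with hK
  have hK1 : 1 ≤ K := by
    have : (0 : ℝ) ≤ c := by positivity
    linarith
  refine ⟨((Real.log 2 + d * Real.log K) / Real.log 2 + d) / Real.log 2, fun n hn a ha => ?_⟩
  have hlogn : Real.log 2 ≤ Real.log ((n : ℝ) + 1) := by
    refine Real.log_le_log (by norm_num) ?_
    have : (1 : ℝ) ≤ n := by exact_mod_cast hn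
    linarith
  have hm : (scaledLength β n : ℝ) + c ≤ K * (n + 1) := by
    have h1 := (Nat.ceil_lt_add_one (a := (n : ℝ) * Real.logb β 2) (by positivity)).le
    have h2 : (0 : ℝ) ≤ n := by positivity
    have h3 : (0 : ℝ) ≤ c := by positivity
    have h4 := mul_nonneg h3 h2
    rw [scaledLength, hK]
    nlinarith
  have h1 : ((2 ^ a.size : ℕ) : ℝ) ≤ 2 * (K * (n + 1)) ^ d := by
    have h2 : 2 ^ a.size ≤ 2 * (scaledLength β n + c) ^ d := (two_pow_size_le a).trans (by omega)
    have h3 : ((2 ^ a.size : ℕ) : ℝ) ≤ 2 * ((scaledLength β n : ℝ) + c) ^ d := by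
      exact_mod_cast h2
    exact h3.trans (mul_le_mul_of_nonneg_left (pow_le_pow_left₀ (by positivity) hm d) (by norm_num))
  have h4 := Real.log_le_log (by positivity) h1
  push_cast at h4
  rw [Real.log_pow, Real.log_mul (by norm_num) (by positivity), Real.log_pow,
    Real.log_mul (by positivity) (by positivity)] at h4
  have hKlog : 0 ≤ Real.log K := Real.log_nonneg hK1
  have h5 : Real.log 2 + d * Real.log K ≤
      (Real.log 2 + d * Real.log K) / Real.log 2 * Real.log ((n : ℝ) + 1) := by
    rw [div_mul_eq_mul_div, le_div_iff₀ hl2]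
    exact mul_le_mul_of_nonneg_left hlogn (by positivity)
  rw [div_mul_eq_mul_div, le_div_iff₀ hl2]
  linarith

end BetaExpansion

theorem mainTheorem11
    (U : List Bool → (ℕ → Bool) → Part (List Bool)) (hU : BetaExpansion.IsUniversal U)
    (β : ℝ) (hβ : β ∈ Set.Ioo (1 : ℝ) 2) (hβalg : IsAlgebraic ℤ β) :
    (∃ C : ℝ, ∀ n : ℕ, 1 ≤ n → ∀ s ∈ Set.Icc (0 : ℝ) 1, ∀ x ∈ BetaExpansion.expansions β s,
      (BetaExpansion.complexity U
        (BetaExpansion.pair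
          (BetaExpansion.take (BetaExpansion.greedyBinary s) n)
          (BetaExpansion.coinTossWord β s
            (BetaExpansion.take x (BetaExpansion.scaledLength β n)))) : ℝ)
        ≤ (BetaExpansion.complexity U
            (BetaExpansion.take x (BetaExpansion.scaledLength β n)) : ℝ)
          + 2 * (n : ℝ) * Real.logb β
              ((BetaExpansion.leadCoeff β : ℝ) * BetaExpansion.outerProduct β)
          + C * Real.log ((n : ℝ) + 1)) ∧
    (BetaExpansion.IsPisot β →
      ∃ C : ℝ, ∀ n : ℕ, 1 ≤ n → ∀ s ∈ Set.Icc (0 : ℝ) 1, ∀ x ∈ BetaExpansion.expansions β s,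
        (BetaExpansion.complexity U
          (BetaExpansion.pair
            (BetaExpansion.take (BetaExpansion.greedyBinary s) n)
            (BetaExpansion.coinTossWord β s
              (BetaExpansion.take x (BetaExpansion.scaledLength β n)))) : ℝ)
          ≤ (BetaExpansion.complexity U
              (BetaExpansion.take x (BetaExpansion.scaledLength β n)) : ℝ)
            + C) := by
  have h0 : 0 ≤ β := by linarith [hβ.1]
  refine ⟨?_, fun hPisot => ?_⟩
  · obtain ⟨c₁, c₀, hsep⟩ := BetaExpansion.exists_thresholdsSeparated hβalg
    obtain ⟨C, hC⟩ := hU.complexity_le_of_primrec (BetaExpansion.primrec_decode h0 hβalg c₁ c₀)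
    obtain ⟨A, hA⟩ := BetaExpansion.exists_size_le_mul_log hβ.1 (9 + ⌈(β - 1)⁻¹⌉₊) 8
    have hl2 : 0 < Real.log 2 := Real.log_pos (by norm_num)
    refine ⟨2 * A + C / Real.log 2, fun n hn s hs x hx => ?_⟩
    obtain ⟨a, ha, hdec⟩ := BetaExpansion.exists_advice hβ hsep hn hs hx
    have h1 := hC (BetaExpansion.take x (BetaExpansion.scaledLength β n)) a
    rw [hdec, ← Nat.cast_le (α := ℝ)] at h1
    push_cast at h1
    have h2 := hA n hn a ha
    -- The argument gives the bound with only the logarithmic error; the linear term is added for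
    -- free.
    have h3 : 0 ≤ 2 * (n : ℝ) * Real.logb β
        ((BetaExpansion.leadCoeff β : ℝ) * BetaExpansion.outerProduct β) :=
      mul_nonneg (by positivity)
        (Real.logb_nonneg hβ.1 (BetaExpansion.one_le_leadCoeff_mul_outerProduct hβalg))
    have h4 : (C : ℝ) ≤ C / Real.log 2 * Real.log ((n : ℝ) + 1) := by
      rw [div_mul_eq_mul_div, le_div_iff₀ hl2]
      refine mul_le_mul_of_nonneg_left (Real.log_le_log (by norm_num) ?_) (by positivity)
      have : (1 : ℝ) ≤ n := by exact_mod_cast hn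
      linarith
    linarith
  · obtain ⟨c₀, hsep⟩ := hPisot.exists_thresholdsSeparated
    obtain ⟨C, hC⟩ := hU.complexity_le_of_primrec (BetaExpansion.primrec_decode h0 hβalg 0 c₀)
    obtain ⟨T, hT⟩ := BetaExpansion.exists_advice_of_zero hβ hsep
    refine ⟨2 * T.size + C, fun n hn s hs x hx => ?_⟩
    obtain ⟨a, ha, hdec⟩ := hT n hn s hs x hx
    have h1 := hC (BetaExpansion.take x (BetaExpansion.scaledLength β n)) a
    have h2 := Nat.size_le_size ha.le
    rw [hdec] at h1
    have h3 : BetaExpansion.complexity U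
        (BetaExpansion.pair (BetaExpansion.take (BetaExpansion.greedyBinary s) n)
          (BetaExpansion.coinTossWord β s
            (BetaExpansion.take x (BetaExpansion.scaledLength β n)))) ≤
        BetaExpansion.complexity U (BetaExpansion.take x (BetaExpansion.scaledLength β n)) +
          (2 * T.size + C) := by omega
    exact_mod_cast h3
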